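/- Notation: $\log(k):=\lfloor\log_2 k\rfloor+1$ is the number of binary digits of $k\ge 1$, $\log\log(n):=\log(\log(n))$, and $\log^*(n)$ is the least $j\ge 0$ such that applying the real function $\log_2$ $j$ times to $n$ gives a value at most $1$. **MPMSC.** Let $\ell,\Delta\ge 1$ and $\Pi=\{p_1,\dots,p_\ell\}$. A Kripke model $(W,R,V)$ over $\Pi$ has *identifiers* if distinct nodes $w$ have distinct identifiers $\mathrm{ID}(w)=b_\ell\cdots b_1$, where $b_i=1$ iff $w\in V(p_i)$; the $i$th neighbour of $w$ is the $R$-successor of $w$ with the $i$th smallest identifier. Schemata are built from $\top$, the $p_i$ and schema variables with $\neg$, $\wedge$ and $\Diamond_1,\dots,\Diamond_\Delta$, where $\Diamond_i\varphi$ holds at $w$ iff $w$ has an $i$th neighbour and $\varphi$ holds there. A $(\Pi,\Delta)$-program of MPMSC has a finite nonempty ordered set of variables (its heads), for each head $X$ a terminal clause $X(0):=\varphi$, where $\varphi$ has no variables and no diamonds, and an iteration clause $X:=_{\varphi_1,\dots,\varphi_m}\psi_1;\dots;\psi_m;\chi$ with $m\ge 0$, where the conditions $\varphi_i$ have no diamonds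 and the $\psi_i$ and $\chi$ have modal depth at most $1$, and sets of attention heads and of print heads. In round $0$ each head has the truth value of its terminal clause. In round $t+1$ it has, at each node, the truth value of its hot body, which is $\psi_i$ for the least $i$ with $\varphi_i$ true and $\chi$ if there is none; all schemata are evaluated with the truth values of round $t$. The output round of a node is the first round in which an attention head is true there, and the node outputs the string of truth values of the print heads in that round. A round $t\geq 1$ is a *global communication round* if at some node the hot body of some head in that round contains a diamond. The *size* of a program is the number of occurrences of proposition symbols, heads and operators in its clauses. A *graph model* is a finite nonempty Kripke model over $\Pi$ with identifiers in which $R$ is symmetric and irreflexive and every node has at most $\Delta$ neighbours. The program *defines a proper $k$-colouring* if on every graph model every node outputs a string $0^a10^b$ with $0\le a<k$, and adjacent nodes output different strings. **Theorem.** For all integers $n\ge 1$ and $\Delta\ge 1$ there is a $(\Pi,\Delta)$-program $\Lambda_{\Delta,n}$ of MPMSC, where $\Pi=\{p_1,\dots,p_{\log(n)}\}$, such that the following hold. The constants in the $\mathcal O$-bounds of 2 and 3 are absolute. In particular, all of this applies to every graph with $n$ nodes, maximum degree at most $\Delta$ and distinct identifiers from $\{1,\dots,n\}$ written in binary. 1.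 $\Lambda_{\Delta,n}$ defines a proper $(\Delta+1)$-colouring. 2. $\Lambda_{\Delta,n}$ has $\mathcal O(\Delta\log(n))+\mathcal O(3^\Delta)$ heads and size $\mathcal O(\Delta^2\log(n))+\mathcal O(3^\Delta)$. 3. On every graph model, the output round of every node is $\mathcal O(\log(n)\cdot\log\log(n)\cdot\log^*(n))+\mathcal O(\Delta 3^\Delta)$. 4. On every graph model, the run of $\Lambda_{\Delta,n}$ has exactly $\log^*(n)+3^\Delta-\Delta+11$ global communication rounds, and none of them comes after the output round of any node. 5. For each fixed $\Delta\ge1$, the size of $\Lambda_{\Delta,n}$ is $\mathcal O(\log n)$ as $n\to\infty$. -/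

import Mathlib

universe u

namespace MPMSC

/-- The number of binary digits of a positive integer, `⌊log₂ n⌋ + 1`. -/
def bitLog (n : ℕ) : ℕ := Nat.log 2 n + 1

/-- The iterated logarithm: the least number of applications of the real function `log₂`
that takes `n` to a value at most `1`. -/
noncomputable def logStar (n : ℕ) : ℕ := sInf {j : ℕ | (Real.logb 2)^[j] (n : ℝ) ≤ 1}

/-- Schemata over the propositions `p_1, …, p_ℓ` (indexed by `Fin ℓ`), the schema variables in
`T` and the diamonds `◇_1, …, ◇_Δ` (indexed by `Fin Δ`). With `T` empty these are the formulas
without schema variables. -/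
inductive Schema (ℓ Δ : ℕ) (T : Type) : Type
  | top : Schema ℓ Δ T
  | prop (i : Fin ℓ) : Schema ℓ Δ T
  | var (X : T) : Schema ℓ Δ T
  | neg (φ : Schema ℓ Δ T) : Schema ℓ Δ T
  | and (φ ψ : Schema ℓ Δ T) : Schema ℓ Δ T
  | dia (i : Fin Δ) (φ : Schema ℓ Δ T) : Schema ℓ Δ T

namespace Schema

variable {ℓ Δ : ℕ} {T : Type}

/-- Modal depth. -/
def md : Schema ℓ Δ T → ℕ
  | top => 0
  | prop _ => 0
  | var _ => 0
  | neg φ => φ.md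
  | and φ ψ => max φ.md ψ.md
  | dia _ φ => φ.md + 1

/-- The number of occurrences of proposition symbols, schema variables and operators. -/
def length : Schema ℓ Δ T → ℕ
  | top => 1
  | prop _ => 1
  | var _ => 1
  | neg φ => φ.length + 1
  | and φ ψ => φ.length + ψ.length + 1
  | dia _ φ => φ.length + 1

end Schema

/-- A Kripke model over `p_1, …, p_ℓ`, all of them propositions that encode identifiers. -/
structure KripkeModel (ℓ : ℕ) (W : Type u) where
  /-- the accessibility relation -/
  R : W → W → Prop
  /-- the valuation -/
  V : Fin ℓ → Set W

namespace KripkeModel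

variable {ℓ : ℕ} {W : Type u} (M : KripkeModel ℓ W)

open Classical in
/-- The identifier of a node, the bit string `b_ℓ … b_1` with `b_i = 1` iff `p_i` holds, read as a
binary number; the order of these numbers is the lexicographic order of the strings. -/
noncomputable def ident (w : W) : ℕ := ∑ i : Fin ℓ, if w ∈ M.V i then 2 ^ (i : ℕ) else 0

/-- `v` is the neighbour of `w` with index `i`, counting from `0` in the order of identifiers. -/
def IsNeighbour (w : W) (i : ℕ) (v : W) : Prop :=
  M.R w v ∧ {x | M.R w x ∧ M.ident x < M.ident v}.ncard = i

/-- Finite nonempty Kripke models with identifiers in which every node has out-degree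
at most `Δ`, and whose accessibility relation is the edge relation of a graph. -/
structure IsGraphModel (Δ : ℕ) : Prop where
  finite : Finite W
  nonempty : Nonempty W
  ident_injective : Function.Injective M.ident
  degree_le : ∀ w, {v | M.R w v}.ncard ≤ Δ
  symm : ∀ v w, M.R v w → M.R w v
  irrefl : ∀ v, ¬ M.R v v

end KripkeModel

/-- Truth of a schema at a node, given the truth values `g` of the schema variables at all nodes. -/
def Schema.Holds {ℓ Δ : ℕ} {T : Type} {W : Type u} (M : KripkeModel ℓ W) (g : W → T → Prop) :
    Schema ℓ Δ T → W → Prop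
  | .top, _ => True
  | .prop i, w => w ∈ M.V i
  | .var X, w => g w X
  | .neg φ, w => ¬ φ.Holds M g w
  | .and φ ψ, w => φ.Holds M g w ∧ ψ.Holds M g w
  | .dia i φ, w => ∃ v, M.IsNeighbour w i v ∧ φ.Holds M g v

/-- The right-hand side of an iteration clause `X :=_{φ_1, …, φ_m} ψ_1; …; ψ_m; χ`: the list of
the pairs `(φ_i, ψ_i)` of a condition and its consequence, and the backup `χ`. An empty list is a
standard clause. -/
structure Rule (ℓ Δ : ℕ) (T : Type) where
  branches : List (Schema ℓ Δ T × Schema ℓ Δ T)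
  backup : Schema ℓ Δ T

namespace Rule

variable {ℓ Δ : ℕ} {T : Type}

open Classical in
/-- The consequence of the first condition that is true at `w`, or the last argument if there is
none. -/
noncomputable def select {W : Type u} (M : KripkeModel ℓ W) (g : W → T → Prop) (w : W) :
    List (Schema ℓ Δ T × Schema ℓ Δ T) → Schema ℓ Δ T → Schema ℓ Δ T
  | [], χ => χ
  | (φ, ψ) :: bs, χ => if φ.Holds M g w then ψ else select M g w bs χ

/-- The consequence of the hot condition, or the backup if that is hot. -/
noncomputable def hotBody {W : Type u} (r : Rule ℓ Δ T) (M : KripkeModel ℓ W) (g : W → T → Prop)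
    (w : W) : Schema ℓ Δ T :=
  select M g w r.branches r.backup

/-- The number of occurrences of symbols in the right-hand side of a clause. -/
def length (r : Rule ℓ Δ T) : ℕ :=
  (r.branches.map fun b => b.1.length + b.2.length).sum + r.backup.length

end Rule

/-- A program of message passing modal substitution calculus over `p_1, …, p_ℓ` with the diamonds
`◇_1, …, ◇_Δ`. Its head predicates, in their fixed order, are the elements of `Fin heads`. -/
structure Program (ℓ Δ : ℕ) where
  heads : ℕ
  heads_pos : 0 < heads
  terminal : Fin heads → Schema ℓ Δ Empty
  rule : Fin heads → Rule ℓ Δ (Fin heads)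
  attention : Finset (Fin heads)
  print : Finset (Fin heads)
  md_terminal : ∀ X, (terminal X).md = 0
  md_condition : ∀ X, ∀ b ∈ (rule X).branches, b.1.md = 0
  md_consequence : ∀ X, ∀ b ∈ (rule X).branches, b.2.md ≤ 1
  md_backup : ∀ X, (rule X).backup.md ≤ 1

namespace Program

variable {ℓ Δ : ℕ} (P : Program ℓ Δ)

/-- The size of a program: the number of occurrences of proposition symbols, head predicates and
operators in all its clauses, including the head predicates on the left-hand sides. -/
def size : ℕ := ∑ X, ((1 + (P.terminal X).length) + (1 + (P.rule X).length))

variable {W : Type u} (M : KripkeModel ℓ W)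

/-- The global configuration of round `t`. -/
noncomputable def config : ℕ → W → Fin P.heads → Prop
  | 0 => fun w X => (P.terminal X).Holds M (fun _ e => e.elim) w
  | t + 1 => fun w X => ((P.rule X).hotBody M (config t) w).Holds M (config t) w

/-- Node `w` accepts in round `t`: this is its output round, the first round in which an attention
predicate is true at `w`. -/
def AcceptsIn (w : W) (t : ℕ) : Prop :=
  (∃ X ∈ P.attention, P.config M t w X) ∧ ∀ s < t, ∀ X ∈ P.attention, ¬ P.config M s w X

open Classical in
/-- The truth values of the print predicates at `w` in round `t`, in the order of the heads. -/
noncomputable def printString (w : W) (t : ℕ) : List Bool :=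
  (P.print.sort (· ≤ ·)).map fun X => decide (P.config M t w X)

/-- Node `w` outputs the string `s` in round `t`. -/
def OutputsIn (w : W) (t : ℕ) (s : List Bool) : Prop :=
  P.AcceptsIn M w t ∧ P.printString M w t = s

/-- The set of global communication rounds: the rounds `t + 1` in which, at some node, the clause
of some head predicate evaluates a body that has a diamond. -/
def commRounds : Set ℕ :=
  {r | ∃ t, r = t + 1 ∧ ∃ w X, 0 < ((P.rule X).hotBody M (P.config M t) w).md}

/-- On every graph model, every node outputs a string `0^a 1 0^b` with `a < k`, and adjacent nodes
output different strings. -/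
def DefinesProperColoring (k : ℕ) : Prop :=
  ∀ (W : Type u) (M : KripkeModel ℓ W), M.IsGraphModel Δ →
    (∀ w, ∃ t a b, a < k ∧
      P.OutputsIn M w t (List.replicate a false ++ true :: List.replicate b false)) ∧
    ∀ v w, M.R v w → ∀ t t' s s', P.OutputsIn M v t s → P.OutputsIn M w t' s' → s ≠ s'

end Program

end MPMSC

open MPMSC Asymptotics Filter

/-!
For each `i`, the edges from a node to its `i`th neighbour form a functional graph, and the
identifiers are a proper colouring of it. A Cole–Vishkin step replaces a colour by the position and
the value of the lowest bit in which it differs from the colour of the successor, so that colours of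
`w` bits become colours below `2 * w`, and `logStar n + 3` steps leave at most six colours. The
colours `5`, `4` and `3` are then removed one after the other by shifting all colours along the
graph, which gives all predecessors of a node the same colour. Every edge belongs to one of the `Δ`
functional graphs, hence the tuple of the `Δ` resulting colours, read as a ternary number, is a
proper colouring by `3 ^ Δ` colours. Finally the colour classes from `Δ + 1` on are recoloured
greedily, one per round.

A modal schema sees only a bounded part of a colour, so a Cole–Vishkin step is spread over a phase
of `ℓ + 4` rounds, where `ℓ` is the length of the identifiers: the colour of the successor is
fetched in one global communication round, and the two colours are then compared locally, bit by
bit, in shift registers, while a binary counter records the position. The clocks that schedule all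
this contain no diamonds. Hence the number of global communication rounds depends only on the
program: there is one for each of the `N` phases, six for the removal of colours, and
`3 ^ Δ - (Δ + 1)` for the greedy part.
-/

namespace MPMSC

/-! ### Binary and iterated logarithms -/

section Logarithms

theorem lt_two_pow_bitLog (n : ℕ) : n < 2 ^ bitLog n :=
  Nat.lt_pow_succ_log_self one_lt_two n

theorem bitLog_le_succ_self (n : ℕ) : bitLog n ≤ n + 1 :=
  Nat.succ_le_succ (Nat.log_le_self 2 n)

theorem logb_natCast_le_bitLog (n : ℕ) : Real.logb 2 n ≤ bitLog n := by
  have h := Nat.lt_floor_add_one (Real.logb (2 : ℕ) n)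
  rw [Real.natFloor_logb_natCast] at h
  exact_mod_cast h.le

theorem sq_le_two_mul_two_pow (m : ℕ) : m ^ 2 ≤ 2 * 2 ^ m := by
  rcases Nat.lt_or_ge m 3 with h | h
  · interval_cases m <;> norm_num
  · induction m, h using Nat.le_induction with
    | base => norm_num
    | succ m hm ih => rw [pow_succ 2]; nlinarith

theorem bitLog_sq_le {w : ℕ} (hw : w ≠ 0) : bitLog w ^ 2 ≤ 4 * w :=
  calc bitLog w ^ 2 ≤ 2 * 2 ^ bitLog w := sq_le_two_mul_two_pow _
    _ = 4 * 2 ^ Nat.log 2 w := by rw [bitLog, pow_succ]; ring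
    _ ≤ 4 * w := Nat.mul_le_mul_left 4 (Nat.pow_log_le_self 2 hw)

theorem logb_two_le_natCast {k : ℕ} {x : ℝ} (hx₁ : 1 < x) (hx : x ≤ k + 2) :
    Real.logb 2 x ≤ k + 1 := by
  have hpow : k + 2 ≤ 2 ^ (k + 1) := (k + 1).lt_two_pow_self
  have hpow' : (k : ℝ) + 2 ≤ 2 ^ (k + 1) := by exact_mod_cast hpow
  rw [Real.logb_le_iff_le_rpow one_lt_two (by linarith)]
  exact_mod_cast hx.trans hpow'

theorem exists_iterate_logb_le_one (k : ℕ) {x : ℝ} (hx : x ≤ k + 1) :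
    ∃ j ≤ k, (Real.logb 2)^[j] x ≤ 1 := by
  induction k generalizing x with
  | zero => exact ⟨0, le_rfl, by simpa using hx⟩
  | succ k ih =>
    rcases le_or_gt x 1 with h | h
    · exact ⟨0, Nat.zero_le _, h⟩
    · obtain ⟨j, hjk, hj⟩ := ih (logb_two_le_natCast h (by push_cast at hx; linarith))
      exact ⟨j + 1, Nat.succ_le_succ hjk, hj⟩

theorem iterate_logb_logStar_le_one (n : ℕ) : (Real.logb 2)^[logStar n] (n : ℝ) ≤ 1 := by
  obtain ⟨j, -, hj⟩ := exists_iterate_logb_le_one n (x := n) (by linarith)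
  exact Nat.sInf_mem (s := {j : ℕ | (Real.logb 2)^[j] (n : ℝ) ≤ 1}) ⟨j, hj⟩

theorem logStar_le_bitLog (n : ℕ) : logStar n ≤ bitLog n := by
  have hlog : Real.logb 2 n ≤ (Nat.log 2 n : ℝ) + 1 := by
    exact_mod_cast logb_natCast_le_bitLog n
  obtain ⟨j, hjn, hj⟩ := exists_iterate_logb_le_one _ hlog
  have hmem : (Real.logb 2)^[j + 1] (n : ℝ) ≤ 1 := hj
  exact (Nat.sInf_le hmem).trans (Nat.succ_le_succ hjn)

theorem one_le_logStar {n : ℕ} (hn : 2 ≤ n) : 1 ≤ logStar n := by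
  by_contra! h
  have hle := iterate_logb_logStar_le_one n
  rw [Nat.lt_one_iff.1 h, Function.iterate_zero_apply, Nat.cast_le_one] at hle
  omega

end Logarithms

/-! ### Colour reduction -/

/-- The number of bits of a colour after a Cole–Vishkin step on colours with `w` bits: the step
produces colours below `2 * w`. -/
def reducedWidth (w : ℕ) : ℕ := Nat.clog 2 (2 * w)

section ReducedWidth

theorem two_mul_le_two_pow_reducedWidth (w : ℕ) : 2 * w ≤ 2 ^ reducedWidth w :=
  Nat.le_pow_clog one_lt_two _

theorem reducedWidth_le_iff {w k : ℕ} : reducedWidth w ≤ k ↔ 2 * w ≤ 2 ^ k :=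
  Nat.clog_le_iff_le_pow one_lt_two

theorem reducedWidth_mono : Monotone reducedWidth := fun _ _ h =>
  Nat.clog_mono_right 2 (Nat.mul_le_mul_left 2 h)

theorem one_le_reducedWidth {w : ℕ} (hw : 1 ≤ w) : 1 ≤ reducedWidth w :=
  Nat.clog_pos one_lt_two (by omega)

theorem two_mul_le_two_pow {k : ℕ} (hk : 3 ≤ k) : 2 * k ≤ 2 ^ k := by
  induction k, hk using Nat.le_induction with
  | base => norm_num
  | succ k hk ih => rw [pow_succ]; omega

theorem iterate_reducedWidth_le {w k : ℕ} (hk : 3 ≤ k) (hw : w ≤ k) (m : ℕ) :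
    reducedWidth^[m] w ≤ k := by
  induction m with
  | zero => exact hw
  | succ m ih =>
    rw [Function.iterate_succ_apply']
    exact (reducedWidth_mono ih).trans (reducedWidth_le_iff.2 (two_mul_le_two_pow hk))

theorem iterate_reducedWidth_le_three_of_le_five {w : ℕ} (hw : w ≤ 5) (m : ℕ) :
    reducedWidth^[m + 2] w ≤ 3 := by
  have h₁ : reducedWidth w ≤ 4 := reducedWidth_le_iff.2 (by omega)
  have h₂ : reducedWidth (reducedWidth w) ≤ 3 := reducedWidth_le_iff.2 (by omega)
  exact iterate_reducedWidth_le le_rfl h₂ m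

theorem natCast_reducedWidth_le {w : ℕ} {x : ℝ} (hx : 2 ≤ x) (hw : (w : ℝ) ≤ x + 4) :
    (reducedWidth w : ℝ) ≤ Real.logb 2 x + 4 := by
  rcases Nat.eq_zero_or_pos w with rfl | hpos
  · have := Real.logb_nonneg one_lt_two (show 1 ≤ x by linarith)
    simp only [reducedWidth, mul_zero, Nat.clog_zero_right, Nat.cast_zero]
    linarith
  · have hw₁ : (1 : ℝ) ≤ w := by exact_mod_cast hpos
    have hlog : 0 ≤ Real.logb 2 (2 * w) := Real.logb_nonneg one_lt_two (by linarith)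
    have h8 : Real.logb 2 8 = 3 := by
      rw [show (8 : ℝ) = 2 ^ (3 : ℕ) by norm_num, Real.logb_pow, Real.logb_self_eq_one one_lt_two]
      norm_num
    calc (reducedWidth w : ℝ) = ⌈Real.logb 2 (2 * w)⌉₊ := by
          rw [reducedWidth, ← Real.natCeil_logb_natCast]; push_cast; rfl
      _ ≤ Real.logb 2 (2 * w) + 1 := (Nat.ceil_lt_add_one hlog).le
      _ ≤ Real.logb 2 (8 * x) + 1 := by
          gcongr 1
          exact Real.logb_le_logb_of_le one_lt_two (by positivity) (by linarith)
      _ = Real.logb 2 x + 4 := by rw [Real.logb_mul (by norm_num) (by linarith), h8]; ring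

theorem iterate_reducedWidth_le_three (j : ℕ) {x : ℝ} {w : ℕ} (hw : (w : ℝ) ≤ x + 4)
    (hx : (Real.logb 2)^[j] x ≤ 1) : reducedWidth^[j + 2] w ≤ 3 := by
  induction j generalizing x w with
  | zero =>
    have hx₁ : x ≤ 1 := hx
    have hw₅ : (w : ℝ) ≤ (5 : ℕ) := by push_cast; linarith
    exact iterate_reducedWidth_le_three_of_le_five (by exact_mod_cast hw₅) 0
  | succ j ih =>
    rcases le_or_gt 2 x with h | h
    · exact ih (natCast_reducedWidth_le h hw) hx
    · have hw₆ : (w : ℝ) < (6 : ℕ) := by push_cast; linarith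
      exact iterate_reducedWidth_le_three_of_le_five (Nat.lt_succ_iff.1 (by exact_mod_cast hw₆)) _

theorem iterate_reducedWidth_bitLog_le_three {n m : ℕ} (hm : logStar n + 2 ≤ m) :
    reducedWidth^[m] (bitLog n) ≤ 3 := by
  have hw : (bitLog n : ℝ) ≤ n + 4 := by
    have : (bitLog n : ℝ) ≤ n + 1 := by exact_mod_cast bitLog_le_succ_self n
    linarith
  obtain ⟨k, rfl⟩ := Nat.exists_eq_add_of_le' hm
  rw [Function.iterate_add_apply]
  exact iterate_reducedWidth_le le_rfl
    (iterate_reducedWidth_le_three _ hw (iterate_logb_logStar_le_one n)) k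

end ReducedWidth

/-- The index of the lowest bit in which `x` and `y` differ (`0` if `x = y`). -/
noncomputable def firstDiff (x y : ℕ) : ℕ := sInf {k | x.testBit k ≠ y.testBit k}

/-- The Cole–Vishkin colour of a node with colour `x` whose successor has colour `y`: the index of
the first bit in which the two differ, followed by the value of this bit in `x`. -/
noncomputable def reduceColour (x y : ℕ) : ℕ :=
  2 * firstDiff x y + (x.testBit (firstDiff x y)).toNat

section ReduceColour

variable {w x y z : ℕ}

theorem testBit_firstDiff_ne (h : x ≠ y) :
    x.testBit (firstDiff x y) ≠ y.testBit (firstDiff x y) := by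
  obtain ⟨k, hk⟩ := Nat.exists_testBit_ne_of_ne h
  exact Nat.sInf_mem (s := {k | x.testBit k ≠ y.testBit k}) ⟨k, hk⟩

theorem testBit_eq_of_lt_firstDiff {k : ℕ} (h : k < firstDiff x y) :
    x.testBit k = y.testBit k :=
  not_not.1 (Nat.notMem_of_lt_sInf h)

theorem firstDiff_lt (hx : x < 2 ^ w) (hy : y < 2 ^ w) (h : x ≠ y) : firstDiff x y < w := by
  by_contra! hw
  have hpow := Nat.pow_le_pow_right two_pos hw
  exact testBit_firstDiff_ne h <|
    (Nat.testBit_lt_two_pow (hx.trans_le hpow)).trans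
      (Nat.testBit_lt_two_pow (hy.trans_le hpow)).symm

theorem reduceColour_lt (hx : x < 2 ^ w) (hy : y < 2 ^ w) (h : x ≠ y) :
    reduceColour x y < 2 * w := by
  have := firstDiff_lt hx hy h
  have := Bool.toNat_le (x.testBit (firstDiff x y))
  unfold reduceColour
  omega

theorem reduceColour_ne (h : x ≠ y) : reduceColour x y ≠ reduceColour y z := by
  intro heq
  have hx := Bool.toNat_lt (x.testBit (firstDiff x y))
  have hy := Bool.toNat_lt (y.testBit (firstDiff y z))
  unfold reduceColour at heq
  have hindex : firstDiff y z = firstDiff x y := by omega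
  rw [hindex] at heq
  have toNat_injective : ∀ a b : Bool, a.toNat = b.toNat → a = b := by decide
  exact testBit_firstDiff_ne h (toNat_injective _ _ (by omega))

theorem testBit_min_firstDiff_eq_iff (h : x ≠ y) (s : ℕ) :
    x.testBit (min s (firstDiff x y)) = y.testBit (min s (firstDiff x y)) ↔
      s < firstDiff x y := by
  rcases lt_or_ge s (firstDiff x y) with hs | hs
  · rw [min_eq_left hs.le]
    exact iff_of_true (testBit_eq_of_lt_firstDiff hs) hs
  · rw [min_eq_right hs]
    exact iff_of_false (testBit_firstDiff_ne h) hs.not_gt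

end ReduceColour

theorem testBit_succ_iff (k b : ℕ) :
    (k + 1).testBit b = true ↔ (k.testBit b ≠ true ↔ ∀ a < b, k.testBit a = true) := by
  induction b generalizing k with
  | zero => simp [Nat.testBit_zero]; omega
  | succ b ih =>
    rw [Nat.testBit_succ, Nat.testBit_succ, Nat.forall_lt_succ_left]
    simp only [Nat.testBit_succ, Nat.testBit_zero, decide_eq_true_eq]
    rcases Nat.mod_two_eq_zero_or_one k with h | h
    · rw [show (k + 1) / 2 = k / 2 by omega]; simp [h]
    · rw [show (k + 1) / 2 = k / 2 + 1 by omega, ih]; simp [h]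

/-! ### Colourings of functional graphs -/

section FunctionalGraph

variable {W : Type u} (f : W → Option W)

/-- Adjacent nodes of the functional graph of the partial function `f` have different colours. -/
def IsProperAlong (x : W → ℕ) : Prop := ∀ ⦃w v⦄, f w = some v → x w ≠ x v

/-- The colour of the successor of `w`. A node without successor gets the element of `{0, 1}` of
the other parity, so that the result always differs from `x w`. -/
def successorColour (x : W → ℕ) (w : W) : ℕ := (f w).elim (1 - x w % 2) x

/-- One Cole–Vishkin step at all nodes. -/
noncomputable def reduceColours (x : W → ℕ) (w : W) : ℕ :=
  reduceColour (x w) (successorColour f x w)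

/-- A colour below `3` that differs from `x` and from `y`. -/
def thirdColour (x y : ℕ) : ℕ :=
  if x ≠ 0 ∧ y ≠ 0 then 0 else if x ≠ 1 ∧ y ≠ 1 then 1 else 2

/-- The colour that replaces the shifted colour `y` in the removal of the colour `e`, for a node
with the old colour `x` whose successor has the shifted colour `z`. -/
def replaceColour (e x y z : ℕ) : ℕ := if y = e then thirdColour x z else y

/-- Shifting all colours against `f` gives all predecessors of a node the same colour, its old
one; after that, the nodes of colour `e` can all be recoloured at once. -/
def removeColour (e : ℕ) (x : W → ℕ) (w : W) : ℕ :=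
  replaceColour e (x w) (successorColour f x w) (successorColour f (successorColour f x) w)

/-- The colouring by `0`, `1`, `2` obtained from `x` by `N` Cole–Vishkin steps and the removal of
the colours `5`, `4` and `3`. -/
noncomputable def threeColouring (N : ℕ) (x : W → ℕ) : W → ℕ :=
  removeColour f 3 (removeColour f 4 (removeColour f 5 ((reduceColours f)^[N] x)))

variable {f} {x : W → ℕ}

theorem successorColour_of_eq_some {w v : W} (h : f w = some v) : successorColour f x w = x v := by
  rw [successorColour, h, Option.elim_some]

theorem IsProperAlong.ne_successorColour (hx : IsProperAlong f x) (w : W) :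
    x w ≠ successorColour f x w := by
  rcases h : f w with _ | v
  · rw [successorColour, h, Option.elim_none]
    omega
  · rw [successorColour_of_eq_some h]
    exact hx h

theorem successorColour_lt {k : ℕ} (hk : 2 ≤ k) (hx : ∀ w, x w < k) (w : W) :
    successorColour f x w < k := by
  rcases h : f w with _ | v
  · rw [successorColour, h, Option.elim_none]
    omega
  · rw [successorColour_of_eq_some h]
    exact hx v

theorem IsProperAlong.reduceColours (hx : IsProperAlong f x) :
    IsProperAlong f (reduceColours f x) := fun w v h => by
  rw [MPMSC.reduceColours, successorColour_of_eq_some h]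
  exact reduceColour_ne (hx h)

theorem reduceColours_lt {m : ℕ} (hm : 1 ≤ m) (hx : IsProperAlong f x) (hlt : ∀ w, x w < 2 ^ m)
    (w : W) : reduceColours f x w < 2 * m :=
  reduceColour_lt (hlt w) (successorColour_lt (Nat.le_self_pow (by omega) 2) hlt w)
    (hx.ne_successorColour w)

theorem IsProperAlong.iterate_reduceColours (hx : IsProperAlong f x) (N : ℕ) :
    IsProperAlong f ((MPMSC.reduceColours f)^[N] x) := by
  induction N with
  | zero => exact hx
  | succ N ih => rw [Function.iterate_succ_apply']; exact ih.reduceColours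

theorem iterate_reduceColours_lt {m : ℕ} (hm : 1 ≤ m) (hx : IsProperAlong f x)
    (hlt : ∀ w, x w < 2 ^ m) (N : ℕ) (w : W) :
    (reduceColours f)^[N] x w < 2 ^ reducedWidth^[N] m := by
  induction N generalizing m x with
  | zero => exact hlt w
  | succ _ ih =>
    exact ih (one_le_reducedWidth hm) hx.reduceColours fun v =>
      (reduceColours_lt hm hx hlt v).trans_le (two_mul_le_two_pow_reducedWidth m)

theorem iterate_reduceColours_lt_six {n N : ℕ} (hx : IsProperAlong f x)
    (hlt : ∀ w, x w < 2 ^ bitLog n) (hN : logStar n + 3 ≤ N) (w : W) :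
    (reduceColours f)^[N] x w < 6 := by
  obtain ⟨N, rfl⟩ := Nat.exists_eq_add_of_le' (Nat.one_le_of_lt hN)
  have hwidth : reducedWidth^[N] (bitLog n) ≤ 3 := iterate_reducedWidth_bitLog_le_three (by omega)
  have hthree (v : W) : (reduceColours f)^[N] x v < 2 ^ 3 :=
    (iterate_reduceColours_lt (Nat.succ_pos _) hx hlt N v).trans_le
      (Nat.pow_le_pow_right two_pos hwidth)
  rw [Function.iterate_succ_apply']
  exact reduceColours_lt (by norm_num) (hx.iterate_reduceColours N) hthree w

theorem thirdColour_lt (x y : ℕ) : thirdColour x y < 3 := by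
  unfold thirdColour; split_ifs <;> omega

theorem thirdColour_ne_left (x y : ℕ) : thirdColour x y ≠ x := by
  unfold thirdColour; split_ifs <;> omega

theorem thirdColour_ne_right (x y : ℕ) : thirdColour x y ≠ y := by
  unfold thirdColour; split_ifs <;> omega

theorem removeColour_lt {e : ℕ} (he : 3 ≤ e) (hx : ∀ w, x w < e + 1) (w : W) :
    removeColour f e x w < e := by
  have hy := successorColour_lt (f := f) (by omega) hx w
  have hthird := thirdColour_lt (x w) (successorColour f (successorColour f x) w)
  unfold removeColour replaceColour
  split_ifs <;> omega

theorem IsProperAlong.removeColour (e : ℕ) (hx : IsProperAlong f x) :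
    IsProperAlong f (removeColour f e x) := fun w v h => by
  have hwv : MPMSC.successorColour f x w = x v := successorColour_of_eq_some h
  have hv := hx.ne_successorColour v
  unfold MPMSC.removeColour replaceColour
  rw [successorColour_of_eq_some (x := MPMSC.successorColour f x) h, hwv]
  split_ifs with hw_removed hv_removed
  · exact absurd (hw_removed.trans hv_removed.symm) hv
  · exact thirdColour_ne_right _ _
  · exact (thirdColour_ne_left _ _).symm
  · exact hv

theorem IsProperAlong.threeColouring (N : ℕ) (hx : IsProperAlong f x) :
    IsProperAlong f (threeColouring f N x) :=
  (((hx.iterate_reduceColours N).removeColour 5).removeColour 4).removeColour 3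

theorem removeColours_lt_three (hx : ∀ w, x w < 6) (w : W) :
    removeColour f 3 (removeColour f 4 (removeColour f 5 x)) w < 3 :=
  removeColour_lt le_rfl (removeColour_lt (by norm_num) (removeColour_lt (by norm_num) hx)) w

end FunctionalGraph

/-! ### Greedy recolouring -/

/-- The number with the ternary digits `c 0, …, c (k - 1)`, from the most significant one. -/
def ternaryCode (c : ℕ → ℕ) : ℕ → ℕ
  | 0 => 0
  | k + 1 => 3 * ternaryCode c k + c k

section TernaryCode

variable {c d : ℕ → ℕ} {k : ℕ}

theorem ternaryCode_lt (hc : ∀ i, c i < 3) (k : ℕ) : ternaryCode c k < 3 ^ k := by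
  induction k with
  | zero => exact one_pos
  | succ k ih =>
    have := hc k
    rw [ternaryCode, pow_succ]
    omega

theorem eq_of_ternaryCode_eq (hc : ∀ i, c i < 3) (hd : ∀ i, d i < 3)
    (h : ternaryCode c k = ternaryCode d k) {i : ℕ} (hi : i < k) : c i = d i := by
  induction k with
  | zero => exact absurd hi i.not_lt_zero
  | succ k ih =>
    have hck := hc k
    have hdk := hd k
    simp only [ternaryCode] at h
    rcases Nat.lt_succ_iff_lt_or_eq.1 hi with hlt | rfl
    · exact ih (by omega) hlt
    · omega

end TernaryCode

section Greedy

variable {W : Type u} (R : W → W → Prop) (k : ℕ) (D : W → ℕ)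

/-- The colours that no neighbour of `w` has in the partial colouring `c`. -/
def freeColours (c : W → Option ℕ) (w : W) : Set ℕ := {a | ∀ v, R w v → c v ≠ some a}

open Classical in
/-- The partial colouring after `r` greedy rounds: initially, the nodes with a number `D w < k`
keep this number as their colour; in each round the nodes with the next number take their least
free colour. -/
noncomputable def greedyColouring : ℕ → W → Option ℕ
  | 0 => fun w => if D w < k then some (D w) else none
  | r + 1 => fun w =>
      if D w = k + r then some (sInf (freeColours R (greedyColouring r) w))
      else greedyColouring r w

variable {R k D}

theorem exists_lt_mem_freeColours {w : W} (hfin : {v | R w v}.Finite)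
    (hdeg : {v | R w v}.ncard < k) (c : W → Option ℕ) : ∃ a < k, a ∈ freeColours R c w := by
  classical
  by_contra! h
  refine hdeg.not_ge ?_
  calc k = (Finset.range k).card := (Finset.card_range k).symm
    _ ≤ (hfin.toFinset.image fun v => (c v).getD 0).card := by
        refine Finset.card_le_card fun a ha => ?_
        have hused := h a (Finset.mem_range.1 ha)
        simp only [freeColours, Set.mem_ofPred_eq, not_forall, not_not] at hused
        obtain ⟨v, hv, hcv⟩ := hused
        exact Finset.mem_image.2 ⟨v, hfin.mem_toFinset.2 hv, by rw [hcv, Option.getD_some]⟩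
    _ ≤ {v | R w v}.ncard :=
        Finset.card_image_le.trans_eq (Set.ncard_eq_toFinset_card _ hfin).symm

theorem sInf_freeColours_mem {w : W} (hfin : {v | R w v}.Finite) (c : W → Option ℕ) :
    sInf (freeColours R c w) ∈ freeColours R c w :=
  let ⟨a, _, ha⟩ := exists_lt_mem_freeColours hfin (Nat.lt_succ_self _) c
  Nat.sInf_mem ⟨a, ha⟩

theorem sInf_freeColours_lt {w : W} (hfin : {v | R w v}.Finite) (hdeg : {v | R w v}.ncard < k)
    (c : W → Option ℕ) : sInf (freeColours R c w) < k :=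
  let ⟨_, hak, ha⟩ := exists_lt_mem_freeColours hfin hdeg c
  (Nat.sInf_le ha).trans_lt hak

theorem isSome_greedyColouring (r : ℕ) (w : W) :
    (greedyColouring R k D r w).isSome ↔ D w < k + r := by
  induction r with
  | zero => by_cases h : D w < k <;> simp [greedyColouring, h]
  | succ r ih =>
    by_cases h : D w = k + r
    · simp [greedyColouring, h]
    · simp only [greedyColouring, h, if_false, ih]
      omega

theorem greedyColouring_lt (hfin : ∀ w, {v | R w v}.Finite) (hdeg : ∀ w, {v | R w v}.ncard < k)
    {r a : ℕ} {w : W} (h : greedyColouring R k D r w = some a) : a < k := by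
  induction r with
  | zero =>
    simp only [greedyColouring, Option.ite_none_right_eq_some, Option.some.injEq] at h
    exact h.2 ▸ h.1
  | succ r ih =>
    simp only [greedyColouring] at h
    split_ifs at h with hturn
    · exact Option.some.inj h ▸ sInf_freeColours_lt (hfin w) (hdeg w) _
    · exact ih h

theorem mem_freeColours_of_greedyColouring (hfin : ∀ w, {v | R w v}.Finite)
    (hsymm : ∀ v w, R v w → R w v) (hD : ∀ v w, R v w → D v ≠ D w) {r a : ℕ} {w : W}
    (h : greedyColouring R k D r w = some a) :
    a ∈ freeColours R (greedyColouring R k D r) w := by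
  intro v hv hva
  induction r with
  | zero =>
    simp only [greedyColouring, Option.ite_none_right_eq_some, Option.some.injEq] at h hva
    exact hD w v hv (h.2.trans hva.2.symm)
  | succ r ih =>
    have hmem u := sInf_freeColours_mem (hfin u) (greedyColouring R k D r)
    simp only [greedyColouring] at h hva
    split_ifs at h hva with hw hv'
    · exact hD w v hv (hw.trans hv'.symm)
    · exact hmem w v hv (hva.trans h.symm)
    · exact hmem v w (hsymm w v hv) (h.trans hva.symm)
    · exact ih h hva

end Greedy

/-! ### Identifiers and neighbours -/

theorem ofBits_eq_sum {m : ℕ} (b : Fin m → Bool) :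
    Nat.ofBits b = ∑ j, if b j then 2 ^ (j : ℕ) else 0 := by
  induction m with
  | zero => rfl
  | succ m ih =>
    rw [Nat.ofBits_succ, ih, Fin.sum_univ_succ, Finset.mul_sum, add_comm]
    congr 1
    · cases b 0 <;> rfl
    · refine Finset.sum_congr rfl fun j _ => ?_
      simp only [Function.comp_apply, mul_ite, mul_zero, Fin.val_succ, pow_succ']

namespace KripkeModel

variable {ℓ Δ : ℕ} {W : Type u} {M : KripkeModel ℓ W}

open Classical in
theorem ident_eq_ofBits (M : KripkeModel ℓ W) (w : W) :
    M.ident w = Nat.ofBits fun j => decide (w ∈ M.V j) := by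
  simp only [ident, ofBits_eq_sum, decide_eq_true_eq]

theorem ident_lt_two_pow (M : KripkeModel ℓ W) (w : W) : M.ident w < 2 ^ ℓ := by
  classical
  exact (M.ident_eq_ofBits w).trans_lt (Nat.ofBits_lt_two_pow _)

theorem testBit_ident (M : KripkeModel ℓ W) (w : W) (j : ℕ) :
    (M.ident w).testBit j = true ↔ ∃ h : j < ℓ, w ∈ M.V ⟨j, h⟩ := by
  classical
  rw [ident_eq_ofBits, Nat.testBit_ofBits]
  split_ifs with h <;> simp [h]

open Classical in
/-- The neighbour of `w` with index `i`, if there is one. -/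
noncomputable def neighbour (M : KripkeModel ℓ W) (i : ℕ) (w : W) : Option W :=
  if h : ∃ v, M.IsNeighbour w i v then some h.choose else none

namespace IsGraphModel

theorem isNeighbour_unique (hM : M.IsGraphModel Δ) {w v v' : W} {i : ℕ}
    (h : M.IsNeighbour w i v) (h' : M.IsNeighbour w i v') : v = v' := by
  have := hM.finite
  wlog hlt : M.ident v < M.ident v' generalizing v v'
  · rcases (not_lt.1 hlt).eq_or_lt with heq | hlt'
    · exact (hM.ident_injective heq).symm
    · exact (this h' h hlt').symm
  have hss : {x | M.R w x ∧ M.ident x < M.ident v} ⊂ {x | M.R w x ∧ M.ident x < M.ident v'} :=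
    ⟨fun x hx => ⟨hx.1, hx.2.trans hlt⟩, fun hsub => (hsub ⟨h.1, hlt⟩).2.false⟩
  have hcard := Set.ncard_lt_ncard hss (Set.toFinite _)
  rw [h.2, h'.2] at hcard
  exact absurd hcard (lt_irrefl i)

theorem neighbour_eq_some_iff (hM : M.IsGraphModel Δ) {w v : W} {i : ℕ} :
    M.neighbour i w = some v ↔ M.IsNeighbour w i v := by
  unfold neighbour
  split_ifs with h
  · rw [Option.some.injEq]
    exact ⟨fun hv => hv ▸ h.choose_spec, hM.isNeighbour_unique h.choose_spec⟩
  · exact ⟨(nomatch ·), fun hv => absurd ⟨v, hv⟩ h⟩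

theorem exists_neighbour_eq_some (hM : M.IsGraphModel Δ) {w v : W} (h : M.R w v) :
    ∃ i < Δ, M.neighbour i w = some v := by
  have := hM.finite
  have hss : {x | M.R w x ∧ M.ident x < M.ident v} ⊂ {x | M.R w x} :=
    ⟨fun x hx => hx.1, fun hsub => (hsub (show v ∈ {x | M.R w x} from h)).2.false⟩
  exact ⟨_, (Set.ncard_lt_ncard hss (Set.toFinite _)).trans_le (hM.degree_le w),
    hM.neighbour_eq_some_iff.2 ⟨h, rfl⟩⟩

theorem rel_of_neighbour_eq_some (hM : M.IsGraphModel Δ) {w v : W} {i : ℕ}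
    (h : M.neighbour i w = some v) : M.R w v :=
  (hM.neighbour_eq_some_iff.1 h).1

theorem isProperAlong_ident (hM : M.IsGraphModel Δ) (i : ℕ) :
    IsProperAlong (M.neighbour i) M.ident := fun w v h heq => by
  obtain rfl := hM.ident_injective heq
  exact hM.irrefl w (hM.rel_of_neighbour_eq_some h)

end IsGraphModel

end KripkeModel

/-! ### Derived connectives and registers -/

attribute [simp] Schema.md Schema.length Schema.Holds

namespace Schema

variable {ℓ Δ : ℕ} {T : Type}

/-- Falsity. -/
def bot : Schema ℓ Δ T := neg top

/-- Disjunction. -/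
def or (φ ψ : Schema ℓ Δ T) : Schema ℓ Δ T := neg (and (neg φ) (neg ψ))

/-- Case distinction. -/
def ite (c φ ψ : Schema ℓ Δ T) : Schema ℓ Δ T := or (and c φ) (and (neg c) ψ)

/-- Exclusive disjunction. -/
def xor (φ ψ : Schema ℓ Δ T) : Schema ℓ Δ T := ite φ (neg ψ) ψ

/-- Conjunction of a list. -/
def conj : List (Schema ℓ Δ T) → Schema ℓ Δ T
  | [] => top
  | φ :: l => and φ (conj l)

/-- Disjunction of a list. -/
def disj : List (Schema ℓ Δ T) → Schema ℓ Δ T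
  | [] => bot
  | φ :: l => or φ (disj l)

/-- The statement that the truth value of `φ` is `b`. -/
def literal (b : Bool) (φ : Schema ℓ Δ T) : Schema ℓ Δ T := if b then φ else neg φ

/-- The Boolean function `f` of the truth values of the given schemata. -/
def table : List (Schema ℓ Δ T) → (List Bool → Bool) → Schema ℓ Δ T
  | [], f => if f [] then top else bot
  | φ :: l, f => ite φ (table l fun bs => f (true :: bs)) (table l fun bs => f (false :: bs))

/-- The bit `j` of a register, that is, of the number whose binary digits are the truth values of
the variables `X 0, …, X (m - 1)`; bits out of range are false. -/
def bit {m : ℕ} (X : Fin m → T) (j : ℕ) : Schema ℓ Δ T :=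
  if h : j < m then var (X ⟨j, h⟩) else bot

/-- The bit `j` of the `successorColour` for the contents of a register and the functional graph of
`i`th neighbours. -/
def successorBit {m : ℕ} (i : Fin Δ) (X : Fin m → T) (j : ℕ) : Schema ℓ Δ T :=
  if j = 0 then ite (dia i top) (dia i (bit X 0)) (neg (bit X 0)) else dia i (bit X j)

section Holds

variable {W : Type u} (M : KripkeModel ℓ W) (g : W → T → Prop) (w : W)

@[simp] theorem holds_bot : ¬ (bot : Schema ℓ Δ T).Holds M g w := not_not.2 trivial

@[simp] theorem holds_or (φ ψ : Schema ℓ Δ T) :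
    (or φ ψ).Holds M g w ↔ φ.Holds M g w ∨ ψ.Holds M g w := or_iff_not_and_not.symm

@[simp] theorem holds_ite (c φ ψ : Schema ℓ Δ T) : (ite c φ ψ).Holds M g w ↔
    (c.Holds M g w ∧ φ.Holds M g w) ∨ (¬ c.Holds M g w ∧ ψ.Holds M g w) := by
  simp [ite]

@[simp] theorem holds_xor (φ ψ : Schema ℓ Δ T) :
    (xor φ ψ).Holds M g w ↔ (¬ φ.Holds M g w ↔ ψ.Holds M g w) := by
  simp only [xor, holds_ite, Holds]
  tauto

@[simp] theorem holds_conj (l : List (Schema ℓ Δ T)) :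
    (conj l).Holds M g w ↔ ∀ φ ∈ l, φ.Holds M g w := by
  induction l with
  | nil => simp [conj]
  | cons φ l ih => simp [conj, ih]

@[simp] theorem holds_disj (l : List (Schema ℓ Δ T)) :
    (disj l).Holds M g w ↔ ∃ φ ∈ l, φ.Holds M g w := by
  induction l with
  | nil => simp [disj]
  | cons φ l ih => simp [disj, ih]

@[simp] theorem holds_literal (b : Bool) (φ : Schema ℓ Δ T) :
    (literal b φ).Holds M g w ↔ (φ.Holds M g w ↔ b = true) := by
  cases b <;> simp [literal]

open Classical in
theorem holds_table (l : List (Schema ℓ Δ T)) (f : List Bool → Bool) :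
    (table l f).Holds M g w ↔ f (l.map fun φ => decide (φ.Holds M g w)) = true := by
  induction l generalizing f with
  | nil => by_cases h : f [] = true <;> simp [table, h]
  | cons φ l ih => by_cases h : φ.Holds M g w <;> simp [table, ih, h]

end Holds

section Registers

variable {m : ℕ} {X : Fin m → T}

open Classical in
/-- The number held by the register with the variables `X` when the truth values of the variables
are given by `g`. -/
noncomputable def registerValue (g : T → Prop) (X : Fin m → T) : ℕ :=
  Nat.ofBits fun j => decide (g (X j))

theorem registerValue_lt (g : T → Prop) (X : Fin m → T) : registerValue g X < 2 ^ m :=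
  Nat.ofBits_lt_two_pow _

theorem testBit_registerValue {g : T → Prop} (j : Fin m) :
    (registerValue g X).testBit j = true ↔ g (X j) := by
  simp [registerValue]

theorem registerValue_eq_iff {g : T → Prop} {y : ℕ} (hy : y < 2 ^ m) :
    registerValue g X = y ↔ ∀ j : Fin m, g (X j) ↔ y.testBit j = true := by
  refine ⟨fun h j => by rw [← h, testBit_registerValue], fun h => Nat.eq_of_testBit_eq fun j => ?_⟩
  rcases lt_or_ge j m with hj | hj
  · rw [Bool.eq_iff_iff, ← h ⟨j, hj⟩]
    exact testBit_registerValue ⟨j, hj⟩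
  · have hpow : 2 ^ m ≤ 2 ^ j := Nat.pow_le_pow_right two_pos hj
    rw [Nat.testBit_lt_two_pow ((registerValue_lt g X).trans_le hpow),
      Nat.testBit_lt_two_pow (hy.trans_le hpow)]

variable {W : Type u} {M : KripkeModel ℓ W} {g : W → T → Prop} {w : W}

theorem holds_bit {j : ℕ} : (bit X j : Schema ℓ Δ T).Holds M g w ↔
    (registerValue (g w) X).testBit j = true := by
  unfold bit
  split_ifs with h
  · exact (testBit_registerValue ⟨j, h⟩).symm
  · rw [registerValue, Nat.testBit_ofBits_ge _ _ (not_lt.1 h)]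
    simp

theorem holds_bit_of_lt {j : ℕ} (h : j < m) :
    (bit X j : Schema ℓ Δ T).Holds M g w ↔ g w (X ⟨j, h⟩) :=
  holds_bit.trans (testBit_registerValue ⟨j, h⟩)

theorem holds_successorBit (hM : M.IsGraphModel Δ) {i : Fin Δ} {j : ℕ} :
    (successorBit i X j).Holds M g w ↔
      (successorColour (M.neighbour i) (fun v => registerValue (g v) X) w).testBit j = true := by
  rcases hv : M.neighbour i w with _ | v
  · have hnone (v : W) : ¬ M.IsNeighbour w i v := by simp [← hM.neighbour_eq_some_iff, hv]
    rcases Nat.eq_zero_or_pos j with rfl | hj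
    · simp [successorBit, successorColour, hnone, hv, holds_bit]
      omega
    · have hlt : 1 - registerValue (g w) X % 2 < 2 ^ j :=
        lt_of_le_of_lt (Nat.sub_le _ _) (Nat.one_lt_two_pow hj.ne')
      simp [successorBit, successorColour, hj.ne', hnone, hv, Nat.testBit_lt_two_pow hlt]
  · have hsome (u : W) : M.IsNeighbour w i u ↔ v = u := by simp [← hM.neighbour_eq_some_iff, hv]
    rw [successorColour_of_eq_some hv, successorBit]
    split_ifs with hj <;> simp [hsome, holds_bit, hj]

end Registers

section Measures

@[simp] theorem md_bot : (bot : Schema ℓ Δ T).md = 0 := rfl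

@[simp] theorem md_or (φ ψ : Schema ℓ Δ T) : (or φ ψ).md = max φ.md ψ.md := rfl

@[simp] theorem md_ite (c φ ψ : Schema ℓ Δ T) :
    (ite c φ ψ).md = max (max c.md φ.md) (max c.md ψ.md) := rfl

@[simp] theorem md_xor (φ ψ : Schema ℓ Δ T) : (xor φ ψ).md = max φ.md ψ.md := by
  simp [xor]

theorem md_conj_le {l : List (Schema ℓ Δ T)} {d : ℕ} (h : ∀ φ ∈ l, φ.md ≤ d) :
    (conj l).md ≤ d := by
  induction l with
  | nil => exact Nat.zero_le d
  | cons φ l ih => simp_all [conj]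

theorem md_disj_le {l : List (Schema ℓ Δ T)} {d : ℕ} (h : ∀ φ ∈ l, φ.md ≤ d) :
    (disj l).md ≤ d := by
  induction l with
  | nil => exact Nat.zero_le d
  | cons φ l ih => simp_all [disj]

@[simp] theorem md_literal (b : Bool) (φ : Schema ℓ Δ T) : (literal b φ).md = φ.md := by
  cases b <;> rfl

theorem md_table_le {l : List (Schema ℓ Δ T)} {f : List Bool → Bool} {d : ℕ}
    (h : ∀ φ ∈ l, φ.md ≤ d) : (table l f).md ≤ d := by
  induction l generalizing f with
  | nil => by_cases h : f [] = true <;> simp [table, h]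
  | cons φ l ih => simp_all [table]

theorem le_md_table {l : List (Schema ℓ Δ T)} {f : List Bool → Bool} {φ : Schema ℓ Δ T}
    (h : φ ∈ l) : φ.md ≤ (table l f).md := by
  induction l generalizing f with
  | nil => exact absurd h List.not_mem_nil
  | cons ψ l ih =>
    simp only [table, md_ite]
    rcases List.mem_cons.1 h with rfl | h
    · exact (le_max_left _ _).trans (le_max_left _ _)
    · exact ((ih h).trans (le_max_right _ _)).trans (le_max_left _ _)

@[simp] theorem md_bit {m : ℕ} (X : Fin m → T) (j : ℕ) : (bit X j : Schema ℓ Δ T).md = 0 := by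
  unfold bit; split_ifs <;> rfl

@[simp] theorem md_successorBit {m : ℕ} (i : Fin Δ) (X : Fin m → T) (j : ℕ) :
    (successorBit i X j : Schema ℓ Δ T).md = 1 := by
  unfold successorBit; split_ifs <;> simp

@[simp] theorem length_bot : (bot : Schema ℓ Δ T).length = 2 := rfl

@[simp] theorem length_or (φ ψ : Schema ℓ Δ T) :
    (or φ ψ).length = φ.length + ψ.length + 4 := by
  simp only [or, length]; omega

@[simp] theorem length_ite (c φ ψ : Schema ℓ Δ T) :
    (ite c φ ψ).length = 2 * c.length + φ.length + ψ.length + 7 := by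
  simp only [ite, length_or, length]; omega

@[simp] theorem length_xor (φ ψ : Schema ℓ Δ T) :
    (xor φ ψ).length = 2 * φ.length + 2 * ψ.length + 8 := by
  simp only [xor, length_ite, length]; omega

theorem length_conj_le {l : List (Schema ℓ Δ T)} {c : ℕ} (h : ∀ φ ∈ l, φ.length ≤ c) :
    (conj l).length ≤ (c + 1) * l.length + 1 := by
  induction l with
  | nil => simp [conj]
  | cons φ l ih =>
    have hl := ih fun ψ hψ => h ψ (List.mem_cons_of_mem _ hψ)
    have hφ := h φ List.mem_cons_self
    simp only [conj, length, List.length_cons, mul_add]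
    omega

theorem length_disj_le {l : List (Schema ℓ Δ T)} {c : ℕ} (h : ∀ φ ∈ l, φ.length ≤ c) :
    (disj l).length ≤ (c + 4) * l.length + 2 := by
  induction l with
  | nil => simp [disj]
  | cons φ l ih =>
    have hl := ih fun ψ hψ => h ψ (List.mem_cons_of_mem _ hψ)
    have hφ := h φ List.mem_cons_self
    simp only [disj, length_or, List.length_cons, mul_add]
    omega

theorem length_literal_le (b : Bool) (φ : Schema ℓ Δ T) :
    (literal b φ).length ≤ φ.length + 1 := by
  cases b <;> simp [literal]

theorem length_table_add_le {l : List (Schema ℓ Δ T)} {f : List Bool → Bool} {c : ℕ}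
    (h : ∀ φ ∈ l, φ.length ≤ c) :
    (table l f).length + (2 * c + 7) ≤ (2 * c + 9) * 2 ^ l.length := by
  induction l generalizing f with
  | nil =>
    have hlength : (table [] f : Schema ℓ Δ T).length ≤ 2 := by
      unfold table; split_ifs <;> simp
    simp only [List.length_nil, pow_zero, mul_one]
    omega
  | cons φ l ih =>
    have hl f := ih (f := f) fun ψ hψ => h ψ (List.mem_cons_of_mem _ hψ)
    have htrue := hl fun bs => f (true :: bs)
    have hfalse := hl fun bs => f (false :: bs)
    have hφ := h φ List.mem_cons_self
    simp only [table, length_ite, List.length_cons, pow_succ, ← mul_assoc]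
    omega

theorem length_bit_le {m : ℕ} (X : Fin m → T) (j : ℕ) :
    (bit X j : Schema ℓ Δ T).length ≤ 2 := by
  unfold bit; split_ifs <;> simp

theorem length_successorBit_le {m : ℕ} (i : Fin Δ) (X : Fin m → T) (j : ℕ) :
    (successorBit i X j : Schema ℓ Δ T).length ≤ 17 := by
  have h := length_bit_le (ℓ := ℓ) (Δ := Δ) X
  unfold successorBit
  split_ifs
  · have := h 0
    simp only [length_ite, length]
    omega
  · have := h j
    simp only [length]
    omega

end Measures

end Schema

/-! ### Programs with an arbitrary finite type of heads -/

section Renaming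

variable {ℓ Δ : ℕ} {T T' : Type}

/-- Renaming of schema variables. -/
def Schema.map (f : T → T') : Schema ℓ Δ T → Schema ℓ Δ T'
  | top => top
  | prop i => prop i
  | var X => var (f X)
  | neg φ => neg (φ.map f)
  | and φ ψ => and (φ.map f) (ψ.map f)
  | dia i φ => dia i (φ.map f)

@[simp] theorem Schema.md_map (f : T → T') (φ : Schema ℓ Δ T) : (φ.map f).md = φ.md := by
  induction φ <;> simp_all [map]

@[simp] theorem Schema.length_map (f : T → T') (φ : Schema ℓ Δ T) :
    (φ.map f).length = φ.length := by
  induction φ <;> simp_all [map]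

variable {W : Type u} {M : KripkeModel ℓ W} {g : W → T' → Prop}

theorem Schema.holds_map {f : T → T'} {φ : Schema ℓ Δ T} {w : W} :
    (φ.map f).Holds M g w ↔ φ.Holds M (fun v X => g v (f X)) w := by
  induction φ generalizing w <;> simp_all [map]

/-- Renaming of schema variables in the right-hand side of a clause. -/
def Rule.map (f : T → T') (r : Rule ℓ Δ T) : Rule ℓ Δ T' where
  branches := r.branches.map fun b => (b.1.map f, b.2.map f)
  backup := r.backup.map f

@[simp] theorem Rule.length_map (f : T → T') (r : Rule ℓ Δ T) : (r.map f).length = r.length := by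
  simp [map, length, Function.comp_def]

theorem Rule.hotBody_map {f : T → T'} {r : Rule ℓ Δ T} {w : W} :
    (r.map f).hotBody M g w = (r.hotBody M (fun v X => g v (f X)) w).map f := by
  obtain ⟨bs, χ⟩ := r
  simp only [hotBody, map]
  induction bs with
  | nil => rfl
  | cons b bs ih =>
    by_cases h : b.1.Holds M (fun v X => g v (f X)) w <;>
      simp [select, Schema.holds_map, ih, h]

end Renaming

/-- A program whose heads are the elements of an arbitrary type. -/
structure TypedProgram (ℓ Δ : ℕ) (T : Type) where
  terminal : T → Schema ℓ Δ Empty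
  rule : T → Rule ℓ Δ T
  attention : Finset T
  print : Finset T
  md_terminal : ∀ X, (terminal X).md = 0
  md_condition : ∀ X, ∀ b ∈ (rule X).branches, b.1.md = 0
  md_consequence : ∀ X, ∀ b ∈ (rule X).branches, b.2.md ≤ 1
  md_backup : ∀ X, (rule X).backup.md ≤ 1

theorem map_decide_eq_eq_replicate {α : Type*} [DecidableEq α] {l : List α} (hl : l.Nodup) {a : α}
    (ha : a ∈ l) : ∃ i j, i < l.length ∧
      l.map (fun x => decide (x = a)) =
        List.replicate i false ++ true :: List.replicate j false := by
  obtain ⟨l₁, l₂, rfl⟩ := List.append_of_mem ha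
  have hfalse {l' : List α} (h : a ∉ l') :
      l'.map (fun x => decide (x = a)) = List.replicate l'.length false := by
    rw [List.eq_replicate_iff, List.length_map]
    simpa using fun x hx => ne_of_mem_of_not_mem hx h
  obtain ⟨h₁, h₂⟩ : a ∉ l₁ ∧ a ∉ l₂ := by
    simpa [not_or] using (List.nodup_middle.1 hl).notMem
  exact ⟨l₁.length, l₂.length, by simp, by simp [hfalse h₁, hfalse h₂]⟩

namespace TypedProgram

variable {ℓ Δ : ℕ} {T : Type} (Q : TypedProgram ℓ Δ T)

/-- The configuration of round `t`. -/
noncomputable def config {W : Type u} (M : KripkeModel ℓ W) : ℕ → W → T → Prop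
  | 0 => fun w X => (Q.terminal X).Holds M (fun _ e => e.elim) w
  | t + 1 => fun w X => ((Q.rule X).hotBody M (config M t) w).Holds M (config M t) w

variable [Fintype T] [Nonempty T]

/-- The program obtained by enumerating the heads. -/
noncomputable def toProgram : Program ℓ Δ where
  heads := Fintype.card T
  heads_pos := Fintype.card_pos
  terminal X := Q.terminal ((Fintype.equivFin T).symm X)
  rule X := (Q.rule ((Fintype.equivFin T).symm X)).map (Fintype.equivFin T)
  attention := Q.attention.map (Fintype.equivFin T).toEmbedding
  print := Q.print.map (Fintype.equivFin T).toEmbedding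
  md_terminal _ := Q.md_terminal _
  md_condition _ := List.forall_mem_map.2 fun b hb =>
    (Schema.md_map _ _).trans (Q.md_condition _ b hb)
  md_consequence _ := List.forall_mem_map.2 fun b hb =>
    (Schema.md_map _ _).trans_le (Q.md_consequence _ b hb)
  md_backup _ := (Schema.md_map _ _).trans_le (Q.md_backup _)

/-- The enumeration of the heads. -/
noncomputable def headEquiv : T ≃ Fin Q.toProgram.heads := Fintype.equivFin T

theorem terminal_toProgram (X : T) : Q.toProgram.terminal (Q.headEquiv X) = Q.terminal X :=
  congrArg Q.terminal ((Fintype.equivFin T).symm_apply_apply X)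

theorem rule_toProgram (X : T) :
    Q.toProgram.rule (Q.headEquiv X) = (Q.rule X).map Q.headEquiv :=
  congrArg (fun Y => (Q.rule Y).map (Fintype.equivFin T)) ((Fintype.equivFin T).symm_apply_apply X)

theorem mem_attention_toProgram {X : T} :
    Q.headEquiv X ∈ Q.toProgram.attention ↔ X ∈ Q.attention :=
  Finset.mem_map' (Fintype.equivFin T).toEmbedding

theorem mem_print_toProgram {X : T} : Q.headEquiv X ∈ Q.toProgram.print ↔ X ∈ Q.print :=
  Finset.mem_map' (Fintype.equivFin T).toEmbedding

theorem card_print_toProgram : Q.toProgram.print.card = Q.print.card :=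
  Finset.card_map (Fintype.equivFin T).toEmbedding

theorem size_toProgram :
    Q.toProgram.size = ∑ X : T, ((1 + (Q.terminal X).length) + (1 + (Q.rule X).length)) := by
  unfold Program.size
  refine (Fintype.sum_equiv Q.headEquiv _ _ fun X => ?_).symm
  rw [terminal_toProgram, rule_toProgram, Rule.length_map]

variable {W : Type u} (M : KripkeModel ℓ W)

theorem config_toProgram_comp (t : ℕ) :
    (fun w X => Q.toProgram.config M t w (Q.headEquiv X)) = Q.config M t := by
  induction t with
  | zero => simp only [Program.config, config, terminal_toProgram]
  | succ t ih =>
    simp only [Program.config, config, rule_toProgram, Rule.hotBody_map, Schema.holds_map, ih]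

theorem config_toProgram (t : ℕ) (w : W) (X : T) :
    Q.toProgram.config M t w (Q.headEquiv X) = Q.config M t w X :=
  congrFun (congrFun (Q.config_toProgram_comp M t) w) X

theorem md_hotBody_toProgram (t : ℕ) (w : W) (X : T) :
    ((Q.toProgram.rule (Q.headEquiv X)).hotBody M (Q.toProgram.config M t) w).md =
      ((Q.rule X).hotBody M (Q.config M t) w).md := by
  rw [rule_toProgram, Rule.hotBody_map, Schema.md_map, config_toProgram_comp]

theorem commRounds_toProgram :
    Q.toProgram.commRounds M =
      {r | ∃ t, r = t + 1 ∧ ∃ w X, 0 < ((Q.rule X).hotBody M (Q.config M t) w).md} := by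
  simp only [Program.commRounds, ← Q.headEquiv.exists_congr_right, md_hotBody_toProgram]

theorem acceptsIn_toProgram {w : W} {t : ℕ} :
    Q.toProgram.AcceptsIn M w t ↔ (∃ X ∈ Q.attention, Q.config M t w X) ∧
      ∀ s < t, ∀ X ∈ Q.attention, ¬ Q.config M s w X := by
  simp only [Program.AcceptsIn, ← Q.headEquiv.exists_congr_right,
    ← Q.headEquiv.forall_congr_right, mem_attention_toProgram, config_toProgram]

theorem printString_toProgram {w : W} {t : ℕ} {X : T} (hX : X ∈ Q.print)
    (h : ∀ Y ∈ Q.print, Q.config M t w Y ↔ Y = X) :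
    ∃ a b, a < Q.print.card ∧ Q.toProgram.printString M w t =
      List.replicate a false ++ true :: List.replicate b false := by
  classical
  have hconfig : ∀ Z ∈ Q.toProgram.print.sort (· ≤ ·),
      decide (Q.toProgram.config M t w Z) = decide (Z = Q.headEquiv X) := by
    intro Z hZ
    obtain ⟨Y, rfl⟩ := Q.headEquiv.surjective Z
    have hY := Q.mem_print_toProgram.1 ((Finset.mem_sort _).1 hZ)
    simp [config_toProgram, h Y hY]
  have hmem : Q.headEquiv X ∈ Q.toProgram.print.sort (· ≤ ·) :=
    (Finset.mem_sort _).2 (Q.mem_print_toProgram.2 hX)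
  rw [Program.printString, List.map_congr_left hconfig, ← card_print_toProgram,
    ← Finset.length_sort (· ≤ ·)]
  exact map_decide_eq_eq_replicate (Finset.sort_nodup _ _) hmem

theorem config_iff_of_printString_eq {v w : W} {t : ℕ}
    (h : Q.toProgram.printString M v t = Q.toProgram.printString M w t) {X : T}
    (hX : X ∈ Q.print) : Q.config M t v X ↔ Q.config M t w X := by
  have hmap := List.map_inj_left.1 h (Q.headEquiv X) (by simp [mem_print_toProgram, hX])
  simpa [config_toProgram] using hmap

end TypedProgram

/-! ### The colouring program -/

/-- The heads of the colouring program. The registers `ring` and `phase` and the heads `step` are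
one-hot counters of the rounds within a phase, of the phases, and of the rounds after the last
phase; `reducing` and `greedy` mark stages of the run. For the functional graph of `i`th neighbours
there are the registers `colour i` and `parent i`, which hold the colours of a node and of its `i`th
neighbour, and `index i`, which counts their equal low bits. The heads `code k c` say that the
sequence of the first `k` colours has the ternary code `c`, `turn` that the node is to choose its
final colour in the next round, and `palette a` that this colour is `a`. -/
inductive Head (ℓ Δ N : ℕ) : Type
  | ring (q : Fin (ℓ + 4))
  | phase (p : Fin N)
  | reducing
  | step (k : Fin (3 ^ Δ + 7))
  | greedy
  | turn
  | colour (i : Fin Δ) (j : Fin (ℓ + 2))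
  | parent (i : Fin Δ) (j : Fin (ℓ + 2))
  | index (i : Fin Δ) (j : Fin (bitLog (ℓ + 2)))
  | code (k : Fin (Δ + 1)) (c : Fin (3 ^ (k : ℕ)))
  | palette (a : Fin (Δ + 1))

namespace Head

variable {ℓ Δ N : ℕ}

/-- The heads as a disjoint union of index types. -/
def equivSum : Head ℓ Δ N ≃ Fin (ℓ + 4) ⊕ Fin N ⊕ Unit ⊕ Fin (3 ^ Δ + 7) ⊕ Unit ⊕ Unit ⊕
    (Fin Δ × Fin (ℓ + 2)) ⊕ (Fin Δ × Fin (ℓ + 2)) ⊕ (Fin Δ × Fin (bitLog (ℓ + 2))) ⊕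
    (Σ k : Fin (Δ + 1), Fin (3 ^ (k : ℕ))) ⊕ Fin (Δ + 1) where
  toFun
    | ring q => .inl q
    | phase p => .inr (.inl p)
    | reducing => .inr (.inr (.inl ()))
    | step k => .inr (.inr (.inr (.inl k)))
    | greedy => .inr (.inr (.inr (.inr (.inl ()))))
    | turn => .inr (.inr (.inr (.inr (.inr (.inl ())))))
    | colour i j => .inr (.inr (.inr (.inr (.inr (.inr (.inl (i, j)))))))
    | parent i j => .inr (.inr (.inr (.inr (.inr (.inr (.inr (.inl (i, j))))))))
    | index i j => .inr (.inr (.inr (.inr (.inr (.inr (.inr (.inr (.inl (i, j)))))))))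
    | code k c => .inr (.inr (.inr (.inr (.inr (.inr (.inr (.inr (.inr (.inl ⟨k, c⟩)))))))))
    | palette a => .inr (.inr (.inr (.inr (.inr (.inr (.inr (.inr (.inr (.inr a)))))))))
  invFun
    | .inl q => ring q
    | .inr (.inl p) => phase p
    | .inr (.inr (.inl ())) => reducing
    | .inr (.inr (.inr (.inl k))) => step k
    | .inr (.inr (.inr (.inr (.inl ())))) => greedy
    | .inr (.inr (.inr (.inr (.inr (.inl ()))))) => turn
    | .inr (.inr (.inr (.inr (.inr (.inr (.inl (i, j))))))) => colour i j
    | .inr (.inr (.inr (.inr (.inr (.inr (.inr (.inl (i, j)))))))) => parent i j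
    | .inr (.inr (.inr (.inr (.inr (.inr (.inr (.inr (.inl (i, j))))))))) => index i j
    | .inr (.inr (.inr (.inr (.inr (.inr (.inr (.inr (.inr (.inl ⟨k, c⟩))))))))) => code k c
    | .inr (.inr (.inr (.inr (.inr (.inr (.inr (.inr (.inr (.inr a))))))))) => palette a
  left_inv X := by cases X <;> rfl
  right_inv X := by rcases X with _ | _ | _ | _ | _ | _ | _ | _ | _ | _ | _ <;> rfl

instance : Fintype (Head ℓ Δ N) := Fintype.ofEquiv _ equivSum.symm

instance : Nonempty (Head ℓ Δ N) := ⟨reducing⟩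

theorem sum_eq (f : Head ℓ Δ N → ℕ) :
    ∑ X, f X = ∑ q, f (ring q) + (∑ p, f (phase p) + (f reducing + (∑ k, f (step k) + (f greedy +
      (f turn + (∑ i, ∑ j, f (colour i j) + (∑ i, ∑ j, f (parent i j) +
      (∑ i, ∑ j, f (index i j) + (∑ k, ∑ c, f (code k c) + ∑ a, f (palette a)))))))))) := by
  rw [← Equiv.sum_comp equivSum.symm]
  simp only [Fintype.sum_sum_type, Fintype.sum_prod_type, Fintype.sum_sigma, Finset.univ_unique,
    Finset.sum_singleton]
  rfl

end Head

namespace Colouring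

open Schema

variable {ℓ Δ N : ℕ}

/-- The last round of the last phase. -/
def last : Schema ℓ Δ (Head ℓ Δ N) := and (bit .ring (ℓ + 3)) (bit .phase (N - 1))

/-- The lowest bits of the registers `colour i` and `parent i` differ. -/
def differ (i : Fin Δ) : Schema ℓ Δ (Head ℓ Δ N) := xor (bit (.colour i) 0) (bit (.parent i) 0)

/-- The bit `j` of the colour that replaces `e`, as a function of the three lowest bits of the old
colour, of the shifted colour, and of the shifted colour of the successor. -/
def removalBit (e j : ℕ) : List Bool → Bool
  | [x₀, x₁, x₂, y₀, y₁, y₂, z₀, z₁, z₂] =>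
    (replaceColour e (Nat.ofBits ![x₀, x₁, x₂]) (Nat.ofBits ![y₀, y₁, y₂])
      (Nat.ofBits ![z₀, z₁, z₂])).testBit j
  | _ => false

/-- The bit `j` of the new colour in the removal of the colour `e`. -/
def removal (e : ℕ) (i : Fin Δ) (j : ℕ) : Schema ℓ Δ (Head ℓ Δ N) :=
  table [bit (.colour i) 0, bit (.colour i) 1, bit (.colour i) 2,
    bit (.parent i) 0, bit (.parent i) 1, bit (.parent i) 2,
    successorBit i (.parent i) 0, successorBit i (.parent i) 1, successorBit i (.parent i) 2]
    (removalBit e j)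

/-- The two lowest bits of the register `colour i` are those of `d`. -/
def digit (i : Fin Δ) (d : ℕ) : Schema ℓ Δ (Head ℓ Δ N) :=
  and (literal (d.testBit 0) (bit (.colour i) 0)) (literal (d.testBit 1) (bit (.colour i) 1))

/-- No neighbour has the final colour `a`. -/
def free (a : Fin (Δ + 1)) : Schema ℓ Δ (Head ℓ Δ N) :=
  conj ((List.finRange Δ).map fun i => neg (dia i (var (.palette a))))

/-- The colour `a` is the least final colour that no neighbour has. -/
def leastFree (a : Fin (Δ + 1)) : Schema ℓ Δ (Head ℓ Δ N) :=
  and (free a) (conj (((List.finRange (Δ + 1)).filter (· < a)).map fun b => neg (free b)))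

/-- The terminal clauses. -/
def terminal : Head ℓ Δ N → Schema ℓ Δ Empty
  | .ring q => if (q : ℕ) = 0 then top else bot
  | .phase p => if (p : ℕ) = 0 then top else bot
  | .reducing => top
  | .colour _ j => if h : (j : ℕ) < ℓ then prop ⟨j, h⟩ else bot
  | _ => bot

/-- The iteration clauses. A phase has `ℓ + 4` rounds: in the first one the registers `parent i` are
loaded, then `colour i` and `parent i` are shifted to the right and counted in `index i` until their
lowest bits differ, and in the last one `colour i` becomes twice the index plus its lowest bit.
After the last phase six rounds remove the colours `5`, `4` and `3`, then the codes are computed and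
the codes from `Δ + 1` on take their turn in choosing a final colour. -/
def rule : Head ℓ Δ N → Rule ℓ Δ (Head ℓ Δ N)
  | .ring q => ⟨[], if (q : ℕ) = 0 then bit .ring (ℓ + 3) else bit .ring (q - 1)⟩
  | .phase p => ⟨[],
      ite (bit .ring (ℓ + 3)) (if (p : ℕ) = 0 then bot else bit .phase (p - 1)) (var (.phase p))⟩
  | .reducing => ⟨[], and (var .reducing) (neg last)⟩
  | .step k => ⟨[], if (k : ℕ) = 0 then last else bit .step (k - 1)⟩
  | .greedy => ⟨[], or (bit .step (6 + Δ)) (and (var .greedy) (neg (bit .step (5 + 3 ^ Δ))))⟩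
  | .turn => ⟨[], disj ((List.range (3 ^ Δ - (Δ + 1))).map fun r =>
      and (bit .step (6 + Δ + r)) (bit (.code (Fin.last Δ)) (Δ + 1 + r)))⟩
  | .colour i j => ⟨[
      (and (var .reducing) (bit .ring 0), var (.colour i j)),
      (and (var .reducing) (bit .ring (ℓ + 3)),
        if (j : ℕ) = 0 then bit (.colour i) 0 else bit (.index i) (j - 1)),
      (and (var .reducing) (differ i), var (.colour i j)),
      (var .reducing, bit (.colour i) (j + 1)),
      (bit .step 1, removal 5 i j),
      (bit .step 3, removal 4 i j),
      (bit .step 5, removal 3 i j)], var (.colour i j)⟩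
  | .parent i j => ⟨[
      (and (var .reducing) (bit .ring 0), successorBit i (.colour i) j),
      (and (var .reducing) (differ i), var (.parent i j)),
      (var .reducing, bit (.parent i) (j + 1)),
      (or (bit .step 0) (or (bit .step 2) (bit .step 4)), successorBit i (.colour i) j)],
      var (.parent i j)⟩
  | .index i j => ⟨[
      (bit .ring 0, bot),
      (differ i, var (.index i j))],
      xor (var (.index i j)) (conj ((List.range j).map fun a => bit (.index i) a))⟩
  | .code ⟨0, _⟩ _ => ⟨[], top⟩
  | .code ⟨k + 1, h⟩ c => ⟨[],
      and (bit (.code ⟨k, Nat.lt_of_succ_lt h⟩) (c / 3))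
        (digit ⟨k, Nat.lt_of_succ_lt_succ h⟩ (c % 3))⟩
  | .palette a => ⟨[
      (bit .step (6 + Δ), bit (.code (Fin.last Δ)) a),
      (var .greedy, ite (var .turn) (leastFree a) (var (.palette a)))], var (.palette a)⟩

section ModalDepth

@[simp] theorem md_last : (last : Schema ℓ Δ (Head ℓ Δ N)).md = 0 := by simp [last]

@[simp] theorem md_differ (i : Fin Δ) : (differ i : Schema ℓ Δ (Head ℓ Δ N)).md = 0 := by
  simp [differ]

@[simp] theorem md_removal (e : ℕ) (i : Fin Δ) (j : ℕ) :
    (removal e i j : Schema ℓ Δ (Head ℓ Δ N)).md = 1 := by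
  refine le_antisymm (md_table_le (by simp)) ?_
  rw [← md_successorBit (ℓ := ℓ) i (Head.parent (N := N) i) 0]
  exact le_md_table (by simp)

@[simp] theorem md_digit (i : Fin Δ) (d : ℕ) : (digit i d : Schema ℓ Δ (Head ℓ Δ N)).md = 0 := by
  simp [digit]

theorem md_free_le (a : Fin (Δ + 1)) : (free a : Schema ℓ Δ (Head ℓ Δ N)).md ≤ 1 :=
  md_conj_le (by simp)

theorem md_leastFree_le (a : Fin (Δ + 1)) : (leastFree a : Schema ℓ Δ (Head ℓ Δ N)).md ≤ 1 :=
  max_le (md_free_le a) (md_conj_le (by simp [md_free_le]))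

theorem md_leastFree_pos (hΔ : 1 ≤ Δ) (a : Fin (Δ + 1)) :
    0 < (leastFree a : Schema ℓ Δ (Head ℓ Δ N)).md := by
  obtain ⟨d, rfl⟩ := Nat.exists_eq_add_of_le' hΔ
  simp [leastFree, free, List.finRange_succ, conj]

theorem md_terminal (X : Head ℓ Δ N) : (terminal X).md = 0 := by
  cases X <;> simp only [terminal] <;> (try split_ifs) <;> rfl

theorem md_condition (X : Head ℓ Δ N) : ∀ b ∈ (rule X).branches, b.1.md = 0 := by
  rcases X with _ | _ | _ | _ | _ | _ | _ | _ | _ | ⟨_ | _, _⟩ | _ <;> simp [rule]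

theorem md_consequence_le (X : Head ℓ Δ N) : ∀ b ∈ (rule X).branches, b.2.md ≤ 1 := by
  rcases X with _ | _ | _ | _ | _ | _ | ⟨i, j⟩ | _ | _ | ⟨_ | _, _⟩ | _ <;>
    simp [rule, md_leastFree_le]
  split_ifs <;> simp

theorem md_backup (X : Head ℓ Δ N) : (rule X).backup.md = 0 := by
  cases X with
  | turn => exact Nat.le_zero.1 (md_disj_le (by simp))
  | index i j =>
    have hconj : (conj ((List.range j).map fun a => bit (.index i) a) :
        Schema ℓ Δ (Head ℓ Δ N)).md = 0 := Nat.le_zero.1 (md_conj_le (by simp))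
    simp [rule, hconj]
  | code k c => obtain ⟨_ | _, _⟩ := k <;> simp [rule]
  | _ =>
    simp only [rule]
    (try split_ifs) <;> simp

end ModalDepth

/-- The colouring program with identifiers of length `ℓ` and `N` phases. -/
def typedProgram (ℓ Δ N : ℕ) : TypedProgram ℓ Δ (Head ℓ Δ N) where
  terminal := terminal
  rule := rule
  attention := {.step ⟨3 ^ Δ + 6, by omega⟩}
  print := Finset.univ.map ⟨Head.palette, fun a b h => by injection h⟩
  md_terminal := md_terminal
  md_condition := md_condition
  md_consequence := md_consequence_le
  md_backup X := (md_backup X).trans_le zero_le_one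

end Colouring

/-! ### Size -/

theorem cube_le_three_pow (d : ℕ) : d ^ 3 ≤ 3 ^ d := by
  rcases Nat.lt_or_ge d 3 with h | h
  · interval_cases d <;> norm_num
  · induction d, h using Nat.le_induction with
    | base => norm_num
    | succ d hd ih =>
      rw [pow_succ 3]
      nlinarith [mul_le_mul hd hd (by norm_num) (by omega)]

theorem sum_three_pow_le (d : ℕ) : ∑ k : Fin (d + 1), 3 ^ (k : ℕ) ≤ 2 * 3 ^ d := by
  rw [Fin.sum_univ_eq_sum_range (fun k => 3 ^ k)]
  induction d with
  | zero => simp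
  | succ d ih => rw [Finset.sum_range_succ, pow_succ]; omega

namespace Colouring

open Schema

variable {ℓ Δ N : ℕ}

theorem length_last_le : (last : Schema ℓ Δ (Head ℓ Δ N)).length ≤ 5 := by
  have hring := length_bit_le (ℓ := ℓ) (Δ := Δ) (T := Head ℓ Δ N) .ring (ℓ + 3)
  have hphase := length_bit_le (ℓ := ℓ) (Δ := Δ) (T := Head ℓ Δ N) .phase (N - 1)
  simp only [last, length]
  omega

theorem length_differ_le (i : Fin Δ) : (differ i : Schema ℓ Δ (Head ℓ Δ N)).length ≤ 16 := by
  have hcolour := length_bit_le (ℓ := ℓ) (Δ := Δ) (T := Head ℓ Δ N) (.colour i) 0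
  have hparent := length_bit_le (ℓ := ℓ) (Δ := Δ) (T := Head ℓ Δ N) (.parent i) 0
  simp only [differ, length_xor]
  omega

theorem length_removal_le (e : ℕ) (i : Fin Δ) (j : ℕ) :
    (removal e i j : Schema ℓ Δ (Head ℓ Δ N)).length ≤ 43 * 2 ^ 9 := by
  have htable {l : List (Schema ℓ Δ (Head ℓ Δ N))} (hl : l.length = 9)
      (h : ∀ φ ∈ l, φ.length ≤ 17) : (table l (removalBit e j)).length ≤ 43 * 2 ^ 9 := by
    have hadd := length_table_add_le (f := removalBit e j) h
    rw [hl] at hadd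
    omega
  have hbit {m : ℕ} (X : Fin m → Head ℓ Δ N) (j : ℕ) :
      (bit X j : Schema ℓ Δ (Head ℓ Δ N)).length ≤ 17 := (length_bit_le X j).trans (by norm_num)
  exact htable rfl (by simp [hbit, length_successorBit_le])

theorem length_digit_le (i : Fin Δ) (d : ℕ) :
    (digit i d : Schema ℓ Δ (Head ℓ Δ N)).length ≤ 7 := by
  have hliteral (j : ℕ) :
      (literal (d.testBit j) (bit (.colour i) j) : Schema ℓ Δ (Head ℓ Δ N)).length ≤ 3 :=
    (length_literal_le _ _).trans (Nat.succ_le_succ (length_bit_le _ j))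
  have hzero := hliteral 0
  have hone := hliteral 1
  simp only [digit, length]
  omega

theorem length_free_le (a : Fin (Δ + 1)) :
    (free a : Schema ℓ Δ (Head ℓ Δ N)).length ≤ 4 * Δ + 1 :=
  (length_conj_le (c := 3) (by simp)).trans_eq (by simp)

theorem length_leastFree_le (a : Fin (Δ + 1)) :
    (leastFree a : Schema ℓ Δ (Head ℓ Δ N)).length ≤ (4 * Δ + 3) * (Δ + 2) := by
  have hconj := length_conj_le (c := 4 * Δ + 2)
    (l := ((List.finRange (Δ + 1)).filter (· < a)).map fun b =>
      (neg (free b) : Schema ℓ Δ (Head ℓ Δ N))) (by simp [length_free_le])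
  have hfilter : ((List.finRange (Δ + 1)).filter (· < a)).length ≤ Δ + 1 :=
    (List.length_filter_le _ _).trans_eq List.length_finRange
  rw [List.length_map] at hconj
  have hmul := Nat.mul_le_mul_left (4 * Δ + 3) hfilter
  have hfree := length_free_le (ℓ := ℓ) (N := N) a
  simp only [leastFree, length]
  linarith

theorem length_terminal_le (X : Head ℓ Δ N) : (terminal X).length ≤ 2 := by
  cases X <;> simp only [terminal] <;> (try split_ifs) <;> simp

/-- A bound on the length of the right-hand side of the iteration clause of a head. -/
def ruleBound : Head ℓ Δ N → ℕ
  | .turn => 9 * 3 ^ Δ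
  | .colour _ _ => 70000
  | .index _ _ => 6 * bitLog (ℓ + 2) + 60
  | .palette _ => (4 * Δ + 3) * (Δ + 2) + 20
  | _ => 100

theorem length_rule_turn_le : (rule (.turn : Head ℓ Δ N)).length ≤ 9 * 3 ^ Δ := by
  have hdisj := length_disj_le (c := 5)
    (l := (List.range (3 ^ Δ - (Δ + 1))).map fun r => (and (bit .step (6 + Δ + r))
      (bit (.code (Fin.last Δ)) (Δ + 1 + r)) : Schema ℓ Δ (Head ℓ Δ N))) (by
    simp only [List.mem_map, forall_exists_index, and_imp, forall_apply_eq_imp_iff₂, length]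
    exact fun r _ => Nat.succ_le_succ (add_le_add (length_bit_le _ _) (length_bit_le _ _)))
  rw [List.length_map, List.length_range] at hdisj
  have hpow : 1 ≤ 3 ^ Δ := Nat.one_le_pow _ _ (by norm_num)
  simp only [rule, Rule.length, List.map_nil, List.sum_nil]
  omega

theorem length_rule_colour_le (i : Fin Δ) (j : Fin (ℓ + 2)) :
    (rule (.colour i j : Head ℓ Δ N)).length ≤ 70000 := by
  have hring := length_bit_le (ℓ := ℓ) (Δ := Δ) (T := Head ℓ Δ N) .ring
  have hstep := length_bit_le (ℓ := ℓ) (Δ := Δ) (T := Head ℓ Δ N) .step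
  have hcolour := length_bit_le (ℓ := ℓ) (Δ := Δ) (T := Head ℓ Δ N) (.colour i)
  have hdiffer := length_differ_le (ℓ := ℓ) (N := N) i
  have hremoval e := length_removal_le (ℓ := ℓ) (N := N) e i j
  have hlast : (if (j : ℕ) = 0 then bit (.colour i) 0 else bit (.index i) (j - 1) :
      Schema ℓ Δ (Head ℓ Δ N)).length ≤ 2 := by
    split_ifs <;> exact length_bit_le _ _
  simp only [rule, Rule.length, List.map_cons, List.map_nil, List.sum_cons, List.sum_nil, length]
  linarith [hring 0, hring (ℓ + 3), hstep 1, hstep 3, hstep 5, hcolour (j + 1), hremoval 5,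
    hremoval 4, hremoval 3]

theorem length_rule_parent_le (i : Fin Δ) (j : Fin (ℓ + 2)) :
    (rule (.parent i j : Head ℓ Δ N)).length ≤ 100 := by
  have hring := length_bit_le (ℓ := ℓ) (Δ := Δ) (T := Head ℓ Δ N) .ring
  have hstep := length_bit_le (ℓ := ℓ) (Δ := Δ) (T := Head ℓ Δ N) .step
  have hparent := length_bit_le (ℓ := ℓ) (Δ := Δ) (T := Head ℓ Δ N) (.parent i)
  have hdiffer := length_differ_le (ℓ := ℓ) (N := N) i
  have hsuccessor := length_successorBit_le (ℓ := ℓ) i (Head.colour (ℓ := ℓ) (N := N) i) j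
  simp only [rule, Rule.length, List.map_cons, List.map_nil, List.sum_cons, List.sum_nil, length,
    length_or]
  linarith [hring 0, hstep 0, hstep 2, hstep 4, hparent (j + 1)]

theorem length_rule_index_le (i : Fin Δ) (j : Fin (bitLog (ℓ + 2))) :
    (rule (.index i j : Head ℓ Δ N)).length ≤ 6 * bitLog (ℓ + 2) + 60 := by
  have hring := length_bit_le (ℓ := ℓ) (Δ := Δ) (T := Head ℓ Δ N) .ring 0
  have hdiffer := length_differ_le (ℓ := ℓ) (N := N) i
  have hconj := length_conj_le (c := 2)
    (l := (List.range j).map fun a => (bit (.index i) a : Schema ℓ Δ (Head ℓ Δ N)))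
    (by simp [length_bit_le])
  rw [List.length_map, List.length_range] at hconj
  simp only [rule, Rule.length, List.map_cons, List.map_nil, List.sum_cons, List.sum_nil,
    length, length_xor, length_bot]
  have := j.isLt
  omega

theorem length_rule_code_le (k : Fin (Δ + 1)) (c : Fin (3 ^ (k : ℕ))) :
    (rule (.code k c : Head ℓ Δ N)).length ≤ 100 := by
  obtain ⟨_ | k, hk⟩ := k
  · simp [rule, Rule.length]
  · have hcode := length_bit_le (ℓ := ℓ) (Δ := Δ) (T := Head ℓ Δ N)
      (.code ⟨k, Nat.lt_of_succ_lt hk⟩) (c / 3)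
    have hdigit := length_digit_le (ℓ := ℓ) (N := N) ⟨k, Nat.lt_of_succ_lt_succ hk⟩ (c % 3)
    simp only [rule, Rule.length, List.map_nil, List.sum_nil, length]
    omega

theorem length_rule_palette_le (a : Fin (Δ + 1)) :
    (rule (.palette a : Head ℓ Δ N)).length ≤ (4 * Δ + 3) * (Δ + 2) + 20 := by
  have hstep := length_bit_le (ℓ := ℓ) (Δ := Δ) (T := Head ℓ Δ N) .step (6 + Δ)
  have hcode := length_bit_le (ℓ := ℓ) (Δ := Δ) (T := Head ℓ Δ N) (.code (Fin.last Δ)) a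
  have hfree := length_leastFree_le (ℓ := ℓ) (N := N) a
  simp only [rule, Rule.length, List.map_cons, List.map_nil, List.sum_cons, List.sum_nil,
    length, length_ite]
  omega

theorem length_rule_le : ∀ X : Head ℓ Δ N, (rule X).length ≤ ruleBound X
  | .turn => length_rule_turn_le
  | .colour i j => length_rule_colour_le i j
  | .parent i j => length_rule_parent_le i j
  | .index i j => length_rule_index_le i j
  | .code k c => length_rule_code_le k c
  | .palette a => length_rule_palette_le a
  | .ring q => by
    have hring := length_bit_le (ℓ := ℓ) (Δ := Δ) (T := Head ℓ Δ N) .ring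
    simp only [rule, Rule.length, ruleBound, List.map_nil, List.sum_nil]
    split_ifs <;> linarith [hring (ℓ + 3), hring (q - 1)]
  | .phase p => by
    have hring := length_bit_le (ℓ := ℓ) (Δ := Δ) (T := Head ℓ Δ N) .ring (ℓ + 3)
    have hphase := length_bit_le (ℓ := ℓ) (Δ := Δ) (T := Head ℓ Δ N) .phase (p - 1)
    simp only [rule, Rule.length, ruleBound, List.map_nil, List.sum_nil, length_ite, length]
    split_ifs <;> (try rw [length_bot]) <;> linarith
  | .reducing => by
    simp only [rule, Rule.length, ruleBound, List.map_nil, List.sum_nil, length]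
    linarith [length_last_le (ℓ := ℓ) (Δ := Δ) (N := N)]
  | .step k => by
    have hlast := length_last_le (ℓ := ℓ) (Δ := Δ) (N := N)
    have hstep := length_bit_le (ℓ := ℓ) (Δ := Δ) (T := Head ℓ Δ N) .step (k - 1)
    simp only [rule, Rule.length, ruleBound, List.map_nil, List.sum_nil]
    split_ifs <;> linarith
  | .greedy => by
    have hstep := length_bit_le (ℓ := ℓ) (Δ := Δ) (T := Head ℓ Δ N) .step
    simp only [rule, Rule.length, ruleBound, List.map_nil, List.sum_nil, length, length_or]
    linarith [hstep (6 + Δ), hstep (5 + 3 ^ Δ)]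

theorem card_head : Fintype.card (Head ℓ Δ N) =
    ℓ + 4 + (N + (1 + (3 ^ Δ + 7 + (1 + (1 + (Δ * (ℓ + 2) + (Δ * (ℓ + 2) +
      (Δ * bitLog (ℓ + 2) + (∑ k : Fin (Δ + 1), 3 ^ (k : ℕ) + (Δ + 1)))))))))) := by
  rw [← Finset.card_univ, Finset.card_eq_sum_ones, Head.sum_eq]
  simp

theorem card_head_le (hℓ : 1 ≤ ℓ) (hΔ : 1 ≤ Δ) (hN : N ≤ ℓ + 6) :
    Fintype.card (Head ℓ Δ N) ≤ 40 * (Δ * ℓ + 3 ^ Δ) := by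
  have hindex := Nat.mul_le_mul_left Δ (bitLog_le_succ_self (ℓ + 2))
  have hℓΔ : ℓ ≤ Δ * ℓ := Nat.le_mul_of_pos_left _ hΔ
  have hΔℓ : Δ ≤ Δ * ℓ := Nat.le_mul_of_pos_right _ hℓ
  have hpow : 1 ≤ 3 ^ Δ := Nat.one_le_pow _ _ (by norm_num)
  have hcodes := sum_three_pow_le Δ
  simp only [card_head, mul_add, mul_one] at *
  omega

theorem sum_ruleBound_le (hℓ : 1 ≤ ℓ) (hΔ : 1 ≤ Δ) (hN : N ≤ ℓ + 6) :
    ∑ X : Head ℓ Δ N, ruleBound X ≤ 300000 * (Δ ^ 2 * ℓ + 3 ^ Δ) := by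
  have hindex : Δ * (bitLog (ℓ + 2) * (6 * bitLog (ℓ + 2) + 60)) ≤ 84 * (Δ * ℓ) + 228 * Δ := by
    have hsq := bitLog_sq_le (w := ℓ + 2) (by omega)
    have hle := bitLog_le_succ_self (ℓ + 2)
    refine (Nat.mul_le_mul_left Δ (m := 84 * ℓ + 228) (by linarith)).trans_eq (by ring)
  have hpalette : (Δ + 1) * ((4 * Δ + 3) * (Δ + 2) + 20) ≤ 42 * Δ ^ 3 + 40 * Δ := by
    have hcube : (Δ + 1) * ((4 * Δ + 3) * (Δ + 2)) ≤ (2 * Δ) * ((7 * Δ) * (3 * Δ)) :=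
      Nat.mul_le_mul (by omega) (Nat.mul_le_mul (by omega) (by omega))
    linarith
  have hsq : Δ * ℓ ≤ Δ ^ 2 * ℓ := Nat.mul_le_mul_right _ (Nat.le_self_pow (by norm_num) _)
  have hℓΔ : ℓ ≤ Δ * ℓ := Nat.le_mul_of_pos_left _ hΔ
  have hΔℓ : Δ ≤ Δ * ℓ := Nat.le_mul_of_pos_right _ hℓ
  have hpow : 1 ≤ 3 ^ Δ := Nat.one_le_pow _ _ (by norm_num)
  have hcube := cube_le_three_pow Δ
  have hcodes := sum_three_pow_le Δ
  rw [Head.sum_eq]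
  simp only [ruleBound, Finset.sum_const, Finset.card_univ, Fintype.card_fin, smul_eq_mul,
    ← Finset.sum_mul]
  linarith

theorem heads_toProgram_le (hℓ : 1 ≤ ℓ) (hΔ : 1 ≤ Δ) (hN : N ≤ ℓ + 6) :
    (typedProgram ℓ Δ N).toProgram.heads ≤ 40 * (Δ * ℓ + 3 ^ Δ) :=
  card_head_le hℓ hΔ hN

theorem size_toProgram_le (hℓ : 1 ≤ ℓ) (hΔ : 1 ≤ Δ) (hN : N ≤ ℓ + 6) :
    (typedProgram ℓ Δ N).toProgram.size ≤ 300160 * (Δ ^ 2 * ℓ + 3 ^ Δ) := by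
  have hsize : (typedProgram ℓ Δ N).toProgram.size ≤ ∑ X : Head ℓ Δ N, (4 + ruleBound X) := by
    rw [TypedProgram.size_toProgram]
    refine Finset.sum_le_sum fun X _ => ?_
    have hterminal := length_terminal_le X
    have hrule := length_rule_le X
    simp only [typedProgram]
    omega
  have hcard := card_head_le hℓ hΔ hN
  have hbound := sum_ruleBound_le hℓ hΔ hN
  have hsq : Δ * ℓ ≤ Δ ^ 2 * ℓ := Nat.mul_le_mul_right _ (Nat.le_self_pow (by norm_num) _)
  rw [Finset.sum_add_distrib, Finset.sum_const, smul_eq_mul, Finset.card_univ] at hsize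
  linarith

end Colouring

/-! ### The run of the colouring program -/

theorem succ_lt_three_pow {d : ℕ} (hd : 1 ≤ d) : d + 1 < 3 ^ d := by
  induction d, hd using Nat.le_induction with
  | base => norm_num
  | succ d _ ih => rw [pow_succ]; omega

namespace Colouring

open Schema

/-- The first round after the last phase. -/
def reductionTime (ℓ N : ℕ) : ℕ := (ℓ + 4) * N

/-- The run of the colouring program. -/
noncomputable def run (Δ N : ℕ) {ℓ : ℕ} {W : Type u} (M : KripkeModel ℓ W) (t : ℕ) :
    W → Head ℓ Δ N → Prop :=
  (typedProgram ℓ Δ N).config M t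

/-- The contents of a register of the colouring program in round `t`. -/
noncomputable def value (N : ℕ) {ℓ Δ m : ℕ} {W : Type u} (M : KripkeModel ℓ W) (t : ℕ)
    (X : Fin m → Head ℓ Δ N) (w : W) : ℕ :=
  registerValue (run Δ N M t w) X

variable {ℓ Δ N : ℕ} {W : Type u} {M : KripkeModel ℓ W} {t : ℕ} {w : W}

theorem run_zero {X : Head ℓ Δ N} :
    run Δ N M 0 w X ↔ (terminal X).Holds M (fun _ e => e.elim) w := Iff.rfl

theorem run_succ {X : Head ℓ Δ N} :
    run Δ N M (t + 1) w X ↔ ((rule X).hotBody M (run Δ N M t) w).Holds M (run Δ N M t) w := Iff.rfl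

section Clock

theorem run_ring {q : Fin (ℓ + 4)} : run Δ N M t w (.ring q) ↔ t % (ℓ + 4) = q := by
  induction t generalizing q with
  | zero =>
    rw [run_zero, terminal, Nat.zero_mod]
    split_ifs with hq
    · exact iff_of_true trivial hq.symm
    · exact iff_of_false (holds_bot M _ w) (Ne.symm hq)
  | succ t ih =>
    have hmod := Nat.mod_lt t (show 0 < ℓ + 4 by omega)
    have hq := q.isLt
    rw [run_succ, Nat.add_mod_eq_ite, Nat.mod_eq_of_lt (show 1 < ℓ + 4 by omega)]
    simp only [rule, Rule.hotBody, Rule.select]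
    split_ifs <;> simp only [holds_bit_of_lt (show ℓ + 3 < ℓ + 4 by omega),
      holds_bit_of_lt (show (q : ℕ) - 1 < ℓ + 4 by omega), ih] <;> omega

theorem holds_ring {q : ℕ} (hq : q < ℓ + 4) :
    (bit Head.ring q : Schema ℓ Δ (Head ℓ Δ N)).Holds M (run Δ N M t) w ↔ t % (ℓ + 4) = q :=
  (holds_bit_of_lt hq).trans run_ring

theorem run_phase {p : Fin N} : run Δ N M t w (.phase p) ↔ t / (ℓ + 4) = p := by
  induction t generalizing p with
  | zero =>
    rw [run_zero, terminal, Nat.zero_div]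
    split_ifs with hp
    · exact iff_of_true trivial hp.symm
    · exact iff_of_false (holds_bot M _ w) (Ne.symm hp)
  | succ t ih =>
    have hmod := Nat.mod_lt t (show 0 < ℓ + 4 by omega)
    have hdiv := Nat.zero_le (t / (ℓ + 4))
    have hp := p.isLt
    rw [run_succ, Nat.add_div (show 0 < ℓ + 4 by omega), Nat.div_eq_of_lt (show 1 < ℓ + 4 by omega),
      Nat.mod_eq_of_lt (show 1 < ℓ + 4 by omega)]
    simp only [rule, Rule.hotBody, Rule.select, holds_ite, Holds, holds_ring (Nat.lt_succ_self _),
      ih]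
    split_ifs <;>
      simp only [holds_bot, and_false, false_or, holds_bit_of_lt (show (p : ℕ) - 1 < N by omega),
        ih] <;>
      omega

variable (hN : 1 ≤ N)
include hN

theorem holds_last : (last : Schema ℓ Δ (Head ℓ Δ N)).Holds M (run Δ N M t) w ↔
    t + 1 = reductionTime ℓ N := by
  obtain ⟨N, rfl⟩ := Nat.exists_eq_add_of_le' hN
  have hdiv_mod := Nat.div_mod_unique (a := t) (c := ℓ + 3) (d := N)
    (show 0 < ℓ + 4 by omega)
  simp only [last, Holds, holds_ring (Nat.lt_succ_self _),
    holds_bit_of_lt (Nat.lt_succ_self N), run_phase, Nat.add_sub_cancel]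
  rw [and_comm, hdiv_mod, reductionTime, mul_add]
  omega

theorem run_reducing : run Δ N M t w .reducing ↔ t < reductionTime ℓ N := by
  induction t with
  | zero =>
    rw [run_zero]
    exact iff_of_true trivial (Nat.mul_pos (Nat.succ_pos _) hN)
  | succ t ih =>
    simp only [run_succ, rule, Rule.hotBody, Rule.select, Holds, holds_last hN, ih]
    omega

theorem run_step {k : Fin (3 ^ Δ + 7)} :
    run Δ N M t w (.step k) ↔ t = reductionTime ℓ N + k := by
  have hpos : 0 < reductionTime ℓ N := Nat.mul_pos (Nat.succ_pos _) hN
  induction t generalizing k with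
  | zero =>
    refine iff_of_false (holds_bot M _ w) ?_
    omega
  | succ t ih =>
    have hk := k.isLt
    simp only [run_succ, rule, Rule.hotBody, Rule.select]
    split_ifs
    · rw [holds_last hN]
      omega
    · simp only [holds_bit_of_lt (show (k : ℕ) - 1 < 3 ^ Δ + 7 by omega), ih]
      omega

theorem holds_step {k : ℕ} (hk : k < 3 ^ Δ + 7) :
    (bit Head.step k : Schema ℓ Δ (Head ℓ Δ N)).Holds M (run Δ N M t) w ↔
      t = reductionTime ℓ N + k :=
  (holds_bit_of_lt hk).trans (run_step hN)

theorem run_greedy (hΔ : 1 ≤ Δ) : run Δ N M t w .greedy ↔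
    reductionTime ℓ N + (6 + Δ) < t ∧ t < reductionTime ℓ N + (6 + 3 ^ Δ) := by
  have hpow := succ_lt_three_pow hΔ
  induction t with
  | zero =>
    refine iff_of_false (holds_bot M _ w) ?_
    omega
  | succ t ih =>
    simp only [run_succ, rule, Rule.hotBody, Rule.select, Holds, holds_or, ih,
      holds_step hN (show 6 + Δ < 3 ^ Δ + 7 by omega),
      holds_step hN (show 5 + 3 ^ Δ < 3 ^ Δ + 7 by omega)]
    omega

end Clock

variable {i : Fin Δ}

section HotBodies

theorem value_lt {m : ℕ} (X : Fin m → Head ℓ Δ N) : value N M t X w < 2 ^ m :=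
  registerValue_lt _ _

theorem holds_bit_value {m j : ℕ} {X : Fin m → Head ℓ Δ N} :
    (bit X j : Schema ℓ Δ (Head ℓ Δ N)).Holds M (run Δ N M t) w ↔
      (value N M t X w).testBit j = true :=
  holds_bit

theorem holds_differ : (differ i : Schema ℓ Δ (Head ℓ Δ N)).Holds M (run Δ N M t) w ↔
    value N M t (.colour i) w % 2 ≠ value N M t (.parent i) w % 2 := by
  simp only [differ, holds_xor, holds_bit_value, Nat.testBit_zero, decide_eq_true_eq]
  omega

theorem value_succ_eq_iff {m y : ℕ} {X : Fin m → Head ℓ Δ N} (hy : y < 2 ^ m) :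
    value N M (t + 1) X w = y ↔ ∀ j, ((rule (X j)).hotBody M (run Δ N M t) w).Holds M
      (run Δ N M t) w ↔ y.testBit j = true :=
  registerValue_eq_iff hy

theorem hotBody_index {j : Fin (bitLog (ℓ + 2))} :
    (rule (.index i j : Head ℓ Δ N)).hotBody M (run Δ N M t) w =
      if t % (ℓ + 4) = 0 then bot
      else if value N M t (.colour i) w % 2 ≠ value N M t (.parent i) w % 2 then
        var (.index i j)
      else xor (var (.index i j)) (conj ((List.range j).map fun a => bit (.index i) a)) := by
  simp only [rule, Rule.hotBody, Rule.select, holds_ring (Nat.succ_pos (ℓ + 3)), holds_differ]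

variable (hN : 1 ≤ N)
include hN

theorem hotBody_colour {j : Fin (ℓ + 2)} :
    (rule (.colour i j : Head ℓ Δ N)).hotBody M (run Δ N M t) w =
      if t < reductionTime ℓ N then
        if t % (ℓ + 4) = 0 then var (.colour i j)
        else if t % (ℓ + 4) = ℓ + 3 then
          if (j : ℕ) = 0 then bit (.colour i) 0 else bit (.index i) (j - 1)
        else if value N M t (.colour i) w % 2 ≠ value N M t (.parent i) w % 2 then
          var (.colour i j)
        else bit (.colour i) (j + 1)
      else if t = reductionTime ℓ N + 1 then removal 5 i j
      else if t = reductionTime ℓ N + 3 then removal 4 i j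
      else if t = reductionTime ℓ N + 5 then removal 3 i j
      else var (.colour i j) := by
  have hpow : 0 < 3 ^ Δ := by positivity
  simp only [rule, Rule.hotBody, Rule.select, Holds, run_reducing hN,
    holds_ring (Nat.succ_pos (ℓ + 3)), holds_ring (Nat.lt_succ_self (ℓ + 3)), holds_differ,
    holds_step hN (show 1 < 3 ^ Δ + 7 by omega), holds_step hN (show 3 < 3 ^ Δ + 7 by omega),
    holds_step hN (show 5 < 3 ^ Δ + 7 by omega)]
  by_cases ht : t < reductionTime ℓ N <;> simp only [ht, true_and, false_and, if_true, if_false]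

theorem hotBody_parent {j : Fin (ℓ + 2)} :
    (rule (.parent i j : Head ℓ Δ N)).hotBody M (run Δ N M t) w =
      if t < reductionTime ℓ N then
        if t % (ℓ + 4) = 0 then successorBit i (.colour i) j
        else if value N M t (.colour i) w % 2 ≠ value N M t (.parent i) w % 2 then
          var (.parent i j)
        else bit (.parent i) (j + 1)
      else if t = reductionTime ℓ N ∨ t = reductionTime ℓ N + 2 ∨ t = reductionTime ℓ N + 4 then
        successorBit i (.colour i) j
      else var (.parent i j) := by
  have hpow : 0 < 3 ^ Δ := by positivity
  simp only [rule, Rule.hotBody, Rule.select, Holds, run_reducing hN, holds_or,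
    holds_ring (Nat.succ_pos (ℓ + 3)), holds_differ, holds_step hN (show 0 < 3 ^ Δ + 7 by omega),
    holds_step hN (show 2 < 3 ^ Δ + 7 by omega), holds_step hN (show 4 < 3 ^ Δ + 7 by omega),
    add_zero]
  by_cases ht : t < reductionTime ℓ N <;> simp only [ht, true_and, false_and, if_true, if_false]

end HotBodies

section Transitions

theorem value_succ_of_hotBody_eq_var {m : ℕ} {X : Fin m → Head ℓ Δ N}
    (h : ∀ j, (rule (X j)).hotBody M (run Δ N M t) w = var (X j)) :
    value N M (t + 1) X w = value N M t X w :=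
  (value_succ_eq_iff (value_lt _)).2 fun j => by
    rw [h]
    exact (testBit_registerValue j).symm

theorem value_succ_of_hotBody_eq_bit {m : ℕ} {X : Fin m → Head ℓ Δ N}
    (h : ∀ j : Fin m, (rule (X j)).hotBody M (run Δ N M t) w = bit X (j + 1)) :
    value N M (t + 1) X w = value N M t X w / 2 :=
  (value_succ_eq_iff ((Nat.div_le_self _ 2).trans_lt (value_lt _))).2 fun j => by
    rw [h, holds_bit_value, Nat.testBit_succ, value]

theorem value_succ_of_hotBody_eq_successorBit (hM : M.IsGraphModel Δ) {m : ℕ} (hm : 1 ≤ m)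
    {X Y : Fin m → Head ℓ Δ N}
    (h : ∀ j : Fin m, (rule (X j)).hotBody M (run Δ N M t) w = successorBit i Y j) :
    value N M (t + 1) X w = successorColour (M.neighbour i) (value N M t Y) w :=
  (value_succ_eq_iff (successorColour_lt (Nat.le_self_pow (Nat.one_le_iff_ne_zero.1 hm) 2)
    (fun _ => value_lt _) w)).2 fun j => by
    rw [h]
    exact holds_successorBit hM

theorem value_colour_zero (M : KripkeModel ℓ W) (i : Fin Δ) (w : W) :
    value N M 0 (.colour i) w = M.ident w :=
  (registerValue_eq_iff ((M.ident_lt_two_pow w).trans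
    (Nat.pow_lt_pow_right one_lt_two (by omega)))).2 fun j => by
    rw [run_zero, terminal, M.testBit_ident]
    split_ifs with hj <;> simp [hj]

theorem value_index_succ_of_ring_eq_zero (h₀ : t % (ℓ + 4) = 0) :
    value N M (t + 1) (.index i) w = 0 :=
  (value_succ_eq_iff (by positivity)).2 fun j => by
    rw [hotBody_index, if_pos h₀]
    simp

variable (hN : 1 ≤ N)
include hN

theorem value_colour_succ_of_ring_eq_zero (ht : t < reductionTime ℓ N) (h₀ : t % (ℓ + 4) = 0) :
    value N M (t + 1) (.colour i) w = value N M t (.colour i) w :=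
  value_succ_of_hotBody_eq_var fun _ => by rw [hotBody_colour hN, if_pos ht, if_pos h₀]

theorem value_parent_succ_of_ring_eq_zero (hM : M.IsGraphModel Δ) (ht : t < reductionTime ℓ N)
    (h₀ : t % (ℓ + 4) = 0) : value N M (t + 1) (.parent i) w =
      successorColour (M.neighbour i) (value N M t (.colour i)) w :=
  value_succ_of_hotBody_eq_successorBit hM (Nat.succ_pos _) fun _ => by
    rw [hotBody_parent hN, if_pos ht, if_pos h₀]

theorem value_succ_of_mod_two_eq (ht : t < reductionTime ℓ N) (h₀ : t % (ℓ + 4) ≠ 0)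
    (hlast : t % (ℓ + 4) ≠ ℓ + 3)
    (heq : value N M t (.colour i) w % 2 = value N M t (.parent i) w % 2)
    (hlt : value N M t (.index i) w + 1 < 2 ^ bitLog (ℓ + 2)) :
    value N M (t + 1) (.colour i) w = value N M t (.colour i) w / 2 ∧
    value N M (t + 1) (.parent i) w = value N M t (.parent i) w / 2 ∧
    value N M (t + 1) (.index i) w = value N M t (.index i) w + 1 := by
  refine ⟨value_succ_of_hotBody_eq_bit fun _ => ?_, value_succ_of_hotBody_eq_bit fun _ => ?_,
    (value_succ_eq_iff hlt).2 fun j => ?_⟩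
  · rw [hotBody_colour hN, if_pos ht, if_neg h₀, if_neg hlast, if_neg (not_not.2 heq)]
  · rw [hotBody_parent hN, if_pos ht, if_neg h₀, if_neg (not_not.2 heq)]
  · have hvar : (var (.index i j) : Schema ℓ Δ (Head ℓ Δ N)).Holds M (run Δ N M t) w ↔
      (value N M t (.index i) w).testBit j = true := (testBit_registerValue j).symm
    rw [hotBody_index, if_neg h₀, if_neg (not_not.2 heq), holds_xor, hvar, testBit_succ_iff]
    simp only [holds_conj, List.forall_mem_map, List.mem_range, holds_bit_value]

theorem value_succ_of_mod_two_ne (ht : t < reductionTime ℓ N) (h₀ : t % (ℓ + 4) ≠ 0)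
    (hlast : t % (ℓ + 4) ≠ ℓ + 3)
    (hne : value N M t (.colour i) w % 2 ≠ value N M t (.parent i) w % 2) :
    value N M (t + 1) (.colour i) w = value N M t (.colour i) w ∧
    value N M (t + 1) (.parent i) w = value N M t (.parent i) w ∧
    value N M (t + 1) (.index i) w = value N M t (.index i) w := by
  refine ⟨value_succ_of_hotBody_eq_var fun _ => ?_, value_succ_of_hotBody_eq_var fun _ => ?_,
    value_succ_of_hotBody_eq_var fun _ => ?_⟩
  · rw [hotBody_colour hN, if_pos ht, if_neg h₀, if_neg hlast, if_pos hne]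
  · rw [hotBody_parent hN, if_pos ht, if_neg h₀, if_pos hne]
  · rw [hotBody_index, if_neg h₀, if_pos hne]

theorem value_colour_succ_of_ring_eq_last (ht : t < reductionTime ℓ N)
    (hlast : t % (ℓ + 4) = ℓ + 3) (hindex : value N M t (.index i) w < ℓ + 2) :
    value N M (t + 1) (.colour i) w =
      2 * value N M t (.index i) w + value N M t (.colour i) w % 2 := by
  have hpow : ℓ + 1 < 2 ^ (ℓ + 1) := Nat.lt_two_pow_self
  refine (value_succ_eq_iff (by rw [pow_succ]; omega)).2 fun j => ?_
  rw [hotBody_colour hN, if_pos ht, if_neg (by omega), if_pos hlast]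
  split_ifs with hj
  · rw [holds_bit_value, hj, Nat.testBit_zero, Nat.testBit_zero, Nat.mul_add_mod, Nat.mod_mod]
  · obtain ⟨k, hk⟩ := Nat.exists_eq_succ_of_ne_zero hj
    rw [holds_bit_value, hk, Nat.succ_sub_one, Nat.succ_eq_add_one, Nat.testBit_succ,
      Nat.mul_add_div two_pos, Nat.div_eq_of_lt (Nat.mod_lt _ two_pos), add_zero]

end Transitions

section Phases

variable (hM : M.IsGraphModel Δ) (hN : 1 ≤ N)
include hM hN

theorem value_scan {p : ℕ} (hp : p < N) {x y : ℕ} (hx : value N M ((ℓ + 4) * p) (.colour i) w = x)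
    (hy : successorColour (M.neighbour i) (value N M ((ℓ + 4) * p) (.colour i)) w = y)
    (hxy : x ≠ y) {s : ℕ} (hs : s ≤ ℓ + 2) :
    value N M ((ℓ + 4) * p + (s + 1)) (.colour i) w = x / 2 ^ min s (firstDiff x y) ∧
    value N M ((ℓ + 4) * p + (s + 1)) (.parent i) w = y / 2 ^ min s (firstDiff x y) ∧
    value N M ((ℓ + 4) * p + (s + 1)) (.index i) w = min s (firstDiff x y) := by
  have hphase : (ℓ + 4) * p + (ℓ + 4) ≤ reductionTime ℓ N := Nat.mul_le_mul_left (ℓ + 4) hp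
  induction s with
  | zero =>
    have h₀ : (ℓ + 4) * p % (ℓ + 4) = 0 := Nat.mul_mod_right _ _
    have ht : (ℓ + 4) * p < reductionTime ℓ N := by omega
    simp only [zero_add, Nat.zero_min, pow_zero, Nat.div_one]
    exact ⟨(value_colour_succ_of_ring_eq_zero hN ht h₀).trans hx,
      (value_parent_succ_of_ring_eq_zero hN hM ht h₀).trans hy,
      value_index_succ_of_ring_eq_zero h₀⟩
  | succ s ih =>
    obtain ⟨hcolour, hparent, hindex⟩ := ih (by omega)
    have hmod : ((ℓ + 4) * p + (s + 1)) % (ℓ + 4) = s + 1 :=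
      (Nat.mul_add_mod _ _ _).trans (Nat.mod_eq_of_lt (by omega))
    have ht : (ℓ + 4) * p + (s + 1) < reductionTime ℓ N := by omega
    have h₀ : ((ℓ + 4) * p + (s + 1)) % (ℓ + 4) ≠ 0 := by omega
    have hlast : ((ℓ + 4) * p + (s + 1)) % (ℓ + 4) ≠ ℓ + 3 := by omega
    have hbit := testBit_min_firstDiff_eq_iff hxy s
    simp only [Nat.testBit_eq_decide_div_mod_eq, decide_eq_decide] at hbit
    by_cases hlt : s < firstDiff x y
    · have hwidth := lt_two_pow_bitLog (ℓ + 2)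
      obtain ⟨hcolour', hparent', hindex'⟩ := value_succ_of_mod_two_eq hN ht h₀ hlast
        (i := i) (w := w) (M := M) (by rw [hcolour, hparent]; omega) (by omega)
      rw [min_eq_left hlt.le] at hcolour hparent hindex
      rw [min_eq_left hlt, pow_succ, ← Nat.div_div_eq_div_mul, ← Nat.div_div_eq_div_mul,
        ← hcolour, ← hparent]
      exact ⟨hcolour', hparent', hindex'.trans (congrArg (· + 1) hindex)⟩
    · obtain ⟨hcolour', hparent', hindex'⟩ := value_succ_of_mod_two_ne hN ht h₀ hlast
        (i := i) (w := w) (M := M) (by rw [hcolour, hparent]; omega)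
      rw [show min (s + 1) (firstDiff x y) = min s (firstDiff x y) by omega]
      exact ⟨hcolour'.trans hcolour, hparent'.trans hparent, hindex'.trans hindex⟩

theorem value_colour_phase_succ {p : ℕ} (hp : p < N)
    (hproper : IsProperAlong (M.neighbour i) (value N M ((ℓ + 4) * p) (.colour i))) (w : W) :
    value N M ((ℓ + 4) * (p + 1)) (.colour i) w =
      reduceColours (M.neighbour i) (value N M ((ℓ + 4) * p) (.colour i)) w := by
  have hphase : (ℓ + 4) * p + (ℓ + 4) ≤ reductionTime ℓ N := Nat.mul_le_mul_left (ℓ + 4) hp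
  have hne := hproper.ne_successorColour w
  have hdiff := firstDiff_lt (value_lt _)
    (successorColour_lt (Nat.le_self_pow (Nat.add_one_ne_zero (ℓ + 1)) 2) (fun _ => value_lt _) w)
    hne
  obtain ⟨hcolour, -, hindex⟩ := value_scan hM hN hp rfl rfl hne le_rfl
  rw [min_eq_right hdiff.le] at hcolour hindex
  have hmod : ((ℓ + 4) * p + (ℓ + 2 + 1)) % (ℓ + 4) = ℓ + 3 :=
    (Nat.mul_add_mod _ _ _).trans (Nat.mod_eq_of_lt (by omega))
  rw [show (ℓ + 4) * (p + 1) = (ℓ + 4) * p + (ℓ + 2 + 1) + 1 by ring,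
    value_colour_succ_of_ring_eq_last hN (by omega) hmod (hindex.trans_lt hdiff), hcolour, hindex,
    reduceColours, reduceColour, Nat.toNat_testBit]

theorem value_colour_phase {p : ℕ} (hp : p ≤ N) :
    value N M ((ℓ + 4) * p) (.colour i) = (reduceColours (M.neighbour i))^[p] M.ident := by
  induction p with
  | zero => exact funext (value_colour_zero M i)
  | succ p ih =>
    have hproper := (hM.isProperAlong_ident i).iterate_reduceColours p
    rw [Function.iterate_succ_apply', ← ih (by omega)]
    exact funext (value_colour_phase_succ hM hN hp (ih (by omega) ▸ hproper))

end Phases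

theorem ofBits_testBit_three (x : ℕ) :
    Nat.ofBits ![x.testBit 0, x.testBit 1, x.testBit 2] = x % 8 := by
  rw [← Nat.ofBits_testBit x 3]
  congr 1
  ext j
  fin_cases j <;> rfl

theorem replaceColour_lt {e x y z b : ℕ} (hb : 3 ≤ b) (hy : y < b) : replaceColour e x y z < b := by
  unfold replaceColour
  split_ifs
  exacts [(thirdColour_lt x z).trans_le hb, hy]

section RemovalOfColours

variable (hM : M.IsGraphModel Δ)
include hM

theorem holds_removal {e j : ℕ} :
    (removal e i j : Schema ℓ Δ (Head ℓ Δ N)).Holds M (run Δ N M t) w ↔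
      (replaceColour e (value N M t (.colour i) w % 8) (value N M t (.parent i) w % 8)
        (successorColour (M.neighbour i) (value N M t (.parent i)) w % 8)).testBit j = true := by
  have hsuccessor (k : ℕ) : (successorBit i (.parent i) k : Schema ℓ Δ (Head ℓ Δ N)).Holds M
      (run Δ N M t) w ↔
        (successorColour (M.neighbour i) (value N M t (.parent i)) w).testBit k = true :=
    holds_successorBit hM
  simp only [removal, holds_table, List.map_cons, List.map_nil, holds_bit_value, hsuccessor,
    Bool.decide_eq_true, removalBit, ofBits_testBit_three]

variable (hN : 1 ≤ N)
include hN

theorem value_colour_removal {m : ℕ} (hm : m < 3) {x : W → ℕ} (hx : ∀ v, x v < 8)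
    (h : value N M (reductionTime ℓ N + 2 * m) (.colour i) = x) :
    value N M (reductionTime ℓ N + 2 * (m + 1)) (.colour i) =
      removeColour (M.neighbour i) (5 - m) x := by
  have hcolour (v : W) : value N M (reductionTime ℓ N + 2 * m + 1) (.colour i) v = x v := by
    rw [← h]
    refine value_succ_of_hotBody_eq_var fun j => ?_
    rw [hotBody_colour hN, if_neg (by omega), if_neg (by omega), if_neg (by omega),
      if_neg (by omega)]
  have hparent : value N M (reductionTime ℓ N + 2 * m + 1) (.parent i) =
      successorColour (M.neighbour i) x := by
    rw [← h]
    refine funext fun v => value_succ_of_hotBody_eq_successorBit hM (Nat.succ_pos _) fun j => ?_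
    rw [hotBody_parent hN, if_neg (by omega), if_pos (by omega)]
  have hy := successorColour_lt (f := M.neighbour i) (by norm_num) hx
  have hz := successorColour_lt (f := M.neighbour i) (by norm_num) hy
  rw [show reductionTime ℓ N + 2 * (m + 1) = reductionTime ℓ N + 2 * m + 1 + 1 by ring]
  ext v
  refine (value_succ_eq_iff (replaceColour_lt ?_ ?_)).2 fun j => ?_
  · calc 3 ≤ 2 ^ 2 := by norm_num
      _ ≤ 2 ^ (ℓ + 2) := Nat.pow_le_pow_right two_pos (by omega)
  · exact hparent ▸ value_lt _
  · have hhot : (rule (.colour i j : Head ℓ Δ N)).hotBody M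
        (run Δ N M (reductionTime ℓ N + 2 * m + 1)) v = removal (5 - m) i j := by
      rw [hotBody_colour hN, if_neg (by omega)]
      interval_cases m <;> simp
    rw [hhot, holds_removal hM, hcolour, hparent, Nat.mod_eq_of_lt (hx v),
      Nat.mod_eq_of_lt (hy v), Nat.mod_eq_of_lt (hz v)]

end RemovalOfColours

theorem value_colour_eq_threeColouring {n : ℕ} {M : KripkeModel (bitLog n) W}
    (hM : M.IsGraphModel Δ) (hN : logStar n + 3 ≤ N) (ht : reductionTime (bitLog n) N + 6 ≤ t) :
    value N M t (.colour i) = threeColouring (M.neighbour i) N M.ident := by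
  have hpos : 1 ≤ N := Nat.one_le_of_lt hN
  induction t, ht using Nat.le_induction with
  | base =>
    have hsix := iterate_reduceColours_lt_six (hM.isProperAlong_ident i) M.ident_lt_two_pow hN
    have hfive := removeColour_lt (f := M.neighbour i) (e := 5) (by norm_num) hsix
    have hfour := removeColour_lt (f := M.neighbour i) (e := 4) (by norm_num) hfive
    refine value_colour_removal hM hpos (m := 2) (by norm_num)
      (fun v => (hfour v).trans (by norm_num)) ?_
    refine value_colour_removal hM hpos (m := 1) (by norm_num)
      (fun v => (hfive v).trans (by norm_num)) ?_
    exact value_colour_removal hM hpos (m := 0) (by norm_num)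
      (fun v => (hsix v).trans (by norm_num)) (value_colour_phase hM hpos le_rfl)
  | succ t ht ih =>
    rw [← ih]
    refine funext fun v => value_succ_of_hotBody_eq_var fun j => ?_
    rw [hotBody_colour hpos, if_neg (by omega), if_neg (by omega), if_neg (by omega),
      if_neg (by omega)]

end Colouring

/-- The number with the ternary digits given by the three-colourings of the graphs of `i`th
neighbours for `i < k`, each of them obtained from the identifiers in `N` Cole–Vishkin steps. -/
noncomputable def colourCode {ℓ : ℕ} {W : Type u} (N : ℕ) (M : KripkeModel ℓ W) (k : ℕ) (w : W) :
    ℕ :=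
  ternaryCode (fun i => threeColouring (M.neighbour i) N M.ident w) k

namespace Colouring

open Schema

section Semantics

variable {ℓ Δ N : ℕ} {W : Type u} {M : KripkeModel ℓ W} {t : ℕ} {w : W} {i : Fin Δ}

theorem holds_digit {d : ℕ} (hd : d < 4) (hx : value N M t (.colour i) w < 4) :
    (digit i d : Schema ℓ Δ (Head ℓ Δ N)).Holds M (run Δ N M t) w ↔
      value N M t (.colour i) w = d := by
  simp only [digit, Holds, holds_literal, holds_bit_value]
  generalize value N M t (.colour i) w = x at hx
  interval_cases x <;> interval_cases d <;> decide

variable {a : Fin (Δ + 1)} {c : W → Option ℕ}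

theorem holds_free (hM : M.IsGraphModel Δ)
    (hc : ∀ v (b : Fin (Δ + 1)), run Δ N M t v (.palette b) ↔ c v = some ↑b) :
    (free a : Schema ℓ Δ (Head ℓ Δ N)).Holds M (run Δ N M t) w ↔
      ↑a ∈ freeColours M.R c w := by
  simp only [free, holds_conj, List.forall_mem_map, List.mem_finRange, forall_const, Holds, hc,
    ← hM.neighbour_eq_some_iff, not_exists, not_and]
  refine ⟨fun h v hv => ?_, fun h i v hv => h v (hM.rel_of_neighbour_eq_some hv)⟩
  obtain ⟨i, hi, hiv⟩ := hM.exists_neighbour_eq_some hv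
  exact h ⟨i, hi⟩ v hiv

theorem holds_leastFree (hM : M.IsGraphModel Δ)
    (hc : ∀ v (b : Fin (Δ + 1)), run Δ N M t v (.palette b) ↔ c v = some ↑b) :
    (leastFree a : Schema ℓ Δ (Head ℓ Δ N)).Holds M (run Δ N M t) w ↔
      sInf (freeColours M.R c w) = a := by
  have := hM.finite
  have hmem := sInf_freeColours_mem (R := M.R) (w := w) (Set.toFinite _) c
  simp only [leastFree, Holds, holds_conj, List.forall_mem_map, List.mem_filter, List.mem_finRange,
    true_and, decide_eq_true_eq, holds_free hM hc]
  refine ⟨fun ⟨ha, hlt⟩ => (Nat.sInf_le ha).antisymm (le_of_not_gt fun h => ?_), fun h => ?_⟩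
  · exact hlt ⟨_, h.trans a.isLt⟩ h hmem
  · exact ⟨h ▸ hmem, fun b hb => Nat.notMem_of_lt_sInf (h ▸ hb)⟩

end Semantics

variable {n Δ N : ℕ} {W : Type u} {M : KripkeModel (bitLog n) W} (hM : M.IsGraphModel Δ)
  (hN : logStar n + 3 ≤ N)
include hM hN

theorem threeColouring_neighbour_lt (i : ℕ) (w : W) :
    threeColouring (M.neighbour i) N M.ident w < 3 :=
  removeColours_lt_three
    (iterate_reduceColours_lt_six (hM.isProperAlong_ident i) M.ident_lt_two_pow hN) w

theorem colourCode_lt (w : W) (k : ℕ) : colourCode N M k w < 3 ^ k :=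
  ternaryCode_lt (fun i => threeColouring_neighbour_lt hM hN i w) k

theorem colourCode_ne (v w : W) (h : M.R v w) : colourCode N M Δ v ≠ colourCode N M Δ w := by
  intro heq
  obtain ⟨i, hi, hvw⟩ := hM.exists_neighbour_eq_some h
  exact (hM.isProperAlong_ident i).threeColouring N hvw
    (eq_of_ternaryCode_eq (fun i => threeColouring_neighbour_lt hM hN i v)
      (fun i => threeColouring_neighbour_lt hM hN i w) heq hi)

theorem run_code {t : ℕ} {w : W} {k : Fin (Δ + 1)} {c : Fin (3 ^ (k : ℕ))}
    (ht : reductionTime (bitLog n) N + 6 + k ≤ t) :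
    run Δ N M t w (.code k c) ↔ colourCode N M k w = c := by
  obtain ⟨k, hk⟩ := k
  induction k generalizing t with
  | zero =>
    obtain ⟨t, rfl⟩ := Nat.exists_eq_add_of_le' (show 1 ≤ t by omega)
    exact iff_of_true trivial (Nat.lt_one_iff.1 c.isLt).symm
  | succ k ih =>
    change reductionTime (bitLog n) N + 6 + (k + 1) ≤ t at ht
    obtain ⟨t, rfl⟩ := Nat.exists_eq_add_of_le' (show 1 ≤ t by omega)
    replace ht : reductionTime (bitLog n) N + 6 + k ≤ t := by omega
    have hdiv : (c : ℕ) / 3 < 3 ^ k := Nat.div_lt_of_lt_mul (c.isLt.trans_eq (pow_succ' 3 k))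
    have hlt := threeColouring_neighbour_lt hM hN k w
    have hcolour : value N M t (.colour ⟨k, Nat.lt_of_succ_lt_succ hk⟩) w =
        threeColouring (M.neighbour k) N M.ident w := by
      rw [value_colour_eq_threeColouring hM hN (by omega)]
    simp only [run_succ, rule, Rule.hotBody, Rule.select, Holds, holds_bit_of_lt hdiv]
    rw [ih (Nat.lt_of_succ_lt hk) ht, holds_digit (by omega) (by omega), hcolour]
    simp only [colourCode, ternaryCode]
    omega

theorem holds_code {t : ℕ} {w : W} {c : ℕ} (ht : reductionTime (bitLog n) N + 6 + Δ ≤ t)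
    (hc : c < 3 ^ Δ) :
    (bit (.code (Fin.last Δ)) c : Schema (bitLog n) Δ (Head (bitLog n) Δ N)).Holds M
      (run Δ N M t) w ↔ colourCode N M Δ w = c :=
  (holds_bit_of_lt hc).trans (run_code hM hN ht)

theorem run_turn {r : ℕ} {w : W} (hr : r < 3 ^ Δ - (Δ + 1)) :
    run Δ N M (reductionTime (bitLog n) N + (7 + Δ + r)) w .turn ↔
      colourCode N M Δ w = Δ + 1 + r := by
  rw [show reductionTime (bitLog n) N + (7 + Δ + r) =
    reductionTime (bitLog n) N + (6 + Δ + r) + 1 by ring, run_succ]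
  simp only [rule, Rule.hotBody, Rule.select, holds_disj, List.mem_map, List.mem_range,
    exists_exists_and_eq_and, Holds]
  constructor
  · rintro ⟨s, hs, hstep, hcode⟩
    rw [holds_step (Nat.one_le_of_lt hN) (by omega)] at hstep
    obtain rfl : s = r := by omega
    exact (holds_code hM hN (by omega) (by omega)).1 hcode
  · exact fun h => ⟨r, hr, (holds_step (Nat.one_le_of_lt hN) (by omega)).2 rfl,
      (holds_code hM hN (by omega) (by omega)).2 h⟩

theorem run_palette (hΔ : 1 ≤ Δ) {r : ℕ} {w : W} {a : Fin (Δ + 1)} (hr : r ≤ 3 ^ Δ - (Δ + 1)) :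
    run Δ N M (reductionTime (bitLog n) N + (7 + Δ + r)) w (.palette a) ↔
      greedyColouring M.R (Δ + 1) (colourCode N M Δ) r w = some ↑a := by
  have hpow := succ_lt_three_pow hΔ
  have hpos : 1 ≤ N := Nat.one_le_of_lt hN
  have ha := a.isLt
  induction r generalizing w a with
  | zero =>
    rw [show reductionTime (bitLog n) N + (7 + Δ + 0) =
      reductionTime (bitLog n) N + (6 + Δ) + 1 by ring, run_succ]
    simp only [rule, Rule.hotBody, Rule.select, holds_step hpos (show 6 + Δ < 3 ^ Δ + 7 by omega),
      if_true, holds_code hM hN (le_of_eq (add_assoc _ _ _)) (ha.trans hpow), greedyColouring,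
      Option.ite_none_right_eq_some, Option.some.injEq]
    omega
  | succ r ih =>
    have hpalette (v : W) (b : Fin (Δ + 1)) := ih (w := v) (a := b) (by omega) b.isLt
    rw [← add_assoc (7 + Δ), ← add_assoc, run_succ]
    simp only [rule, Rule.hotBody, Rule.select, holds_step hpos (show 6 + Δ < 3 ^ Δ + 7 by omega),
      Holds, run_greedy hpos hΔ]
    rw [if_neg (by omega), if_pos (by omega)]
    simp only [holds_ite, Holds, run_turn hM hN (show r < 3 ^ Δ - (Δ + 1) by omega),
      holds_leastFree hM hpalette, hpalette, greedyColouring]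
    split_ifs with h <;> simp [h]

end Colouring

/-! ### Global communication rounds -/

namespace Rule

variable {ℓ Δ : ℕ} {T : Type}

theorem md_hotBody_le {r : Rule ℓ Δ T} {d : ℕ} (hbranches : ∀ b ∈ r.branches, b.2.md ≤ d)
    (hbackup : r.backup.md ≤ d) {W : Type u} (M : KripkeModel ℓ W) (g : W → T → Prop) (w : W) :
    (r.hotBody M g w).md ≤ d := by
  obtain ⟨bs, χ⟩ := r
  unfold hotBody
  induction bs with
  | nil => exact hbackup
  | cons b bs ih =>
    rw [select]
    split_ifs
    · exact hbranches b List.mem_cons_self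
    · exact ih (fun b' hb' => hbranches b' (List.mem_cons_of_mem b hb')) hbackup

end Rule

namespace Colouring

open Schema

/-- The rounds before the global communication rounds: in the first round of each phase and in the
six rounds after the last phase the three-colourings are exchanged, and while the codes take turns
the final colours are. -/
def exchangeTimes (ℓ Δ N : ℕ) : Finset ℕ :=
  (Finset.range N).image ((ℓ + 4) * ·) ∪
    (Finset.Ico (reductionTime ℓ N) (reductionTime ℓ N + 6) ∪
      Finset.Ico (reductionTime ℓ N + (7 + Δ)) (reductionTime ℓ N + (6 + 3 ^ Δ)))

theorem mem_image_mul_range_iff {ℓ N t : ℕ} : t ∈ (Finset.range N).image ((ℓ + 4) * ·) ↔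
    t < reductionTime ℓ N ∧ t % (ℓ + 4) = 0 := by
  simp only [Finset.mem_image, Finset.mem_range]
  constructor
  · rintro ⟨p, hp, rfl⟩
    exact ⟨Nat.mul_lt_mul_of_pos_left hp (Nat.succ_pos _), Nat.mul_mod_right _ _⟩
  · rintro ⟨ht, h₀⟩
    obtain ⟨p, rfl⟩ := Nat.dvd_of_mod_eq_zero h₀
    exact ⟨p, Nat.lt_of_mul_lt_mul_left ht, rfl⟩

theorem card_exchangeTimes {ℓ Δ N : ℕ} (hΔ : 1 ≤ Δ) :
    (exchangeTimes ℓ Δ N).card = N + 6 + (3 ^ Δ - Δ - 1) := by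
  have hpow := succ_lt_three_pow hΔ
  rw [exchangeTimes, Finset.card_union_of_disjoint, Finset.card_union_of_disjoint,
    Finset.card_image_of_injective _ (mul_right_injective₀ (Nat.succ_ne_zero _)),
    Finset.card_range, Nat.card_Ico, Nat.card_Ico]
  · omega
  · rw [Finset.disjoint_left]
    intro t
    simp only [Finset.mem_Ico]
    omega
  · rw [Finset.disjoint_left]
    intro t
    simp only [mem_image_mul_range_iff, Finset.mem_union, Finset.mem_Ico]
    omega

section HotBodies

variable {ℓ Δ N : ℕ} {W : Type u} {M : KripkeModel ℓ W} {t : ℕ} {w : W} (hN : 1 ≤ N)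
include hN

theorem md_hotBody_colour_pos_iff {i : Fin Δ} {j : Fin (ℓ + 2)} :
    0 < ((rule (.colour i j : Head ℓ Δ N)).hotBody M (run Δ N M t) w).md ↔
      t = reductionTime ℓ N + 1 ∨ t = reductionTime ℓ N + 3 ∨ t = reductionTime ℓ N + 5 := by
  rw [hotBody_colour hN]
  split_ifs <;> simp <;> omega

theorem md_hotBody_parent_pos_iff {i : Fin Δ} {j : Fin (ℓ + 2)} :
    0 < ((rule (.parent i j : Head ℓ Δ N)).hotBody M (run Δ N M t) w).md ↔
      (t < reductionTime ℓ N ∧ t % (ℓ + 4) = 0) ∨ t = reductionTime ℓ N ∨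
        t = reductionTime ℓ N + 2 ∨ t = reductionTime ℓ N + 4 := by
  rw [hotBody_parent hN]
  split_ifs <;> simp <;> omega

theorem md_hotBody_palette_pos_iff (hΔ : 1 ≤ Δ) {a : Fin (Δ + 1)} :
    0 < ((rule (.palette a : Head ℓ Δ N)).hotBody M (run Δ N M t) w).md ↔
      reductionTime ℓ N + (6 + Δ) < t ∧ t < reductionTime ℓ N + (6 + 3 ^ Δ) := by
  have hpow := succ_lt_three_pow hΔ
  simp only [rule, Rule.hotBody, Rule.select, Holds, run_greedy hN hΔ,
    holds_step hN (show 6 + Δ < 3 ^ Δ + 7 by omega)]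
  split_ifs <;> simp [md_leastFree_pos hΔ] <;> omega

theorem exists_md_hotBody_pos_iff [Nonempty W] (hΔ : 1 ≤ Δ) :
    (∃ w, ∃ X : Head ℓ Δ N, 0 < ((rule X).hotBody M (run Δ N M t) w).md) ↔
      t ∈ exchangeTimes ℓ Δ N := by
  simp only [exchangeTimes, Finset.mem_union, mem_image_mul_range_iff, Finset.mem_Ico]
  constructor
  · rintro ⟨w, X, hX⟩
    rcases X with _ | _ | _ | _ | _ | _ | _ | _ | _ | ⟨_ | _, _⟩ | _
    case colour => have := (md_hotBody_colour_pos_iff hN).1 hX; omega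
    case parent => have := (md_hotBody_parent_pos_iff hN).1 hX; omega
    case palette => have := (md_hotBody_palette_pos_iff hN hΔ).1 hX; omega
    all_goals
      refine absurd (Rule.md_hotBody_le ?_ (md_backup _).le _ _ _) hX.not_ge
      simp [rule]
  · intro ht
    obtain ⟨w⟩ := ‹Nonempty W›
    refine ⟨w, ?_⟩
    by_cases hcolour : t = reductionTime ℓ N + 1 ∨ t = reductionTime ℓ N + 3 ∨
        t = reductionTime ℓ N + 5
    · exact ⟨.colour ⟨0, hΔ⟩ 0, (md_hotBody_colour_pos_iff hN).2 hcolour⟩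
    by_cases hpalette : reductionTime ℓ N + (6 + Δ) < t
    · exact ⟨.palette 0, (md_hotBody_palette_pos_iff hN hΔ).2 (by omega)⟩
    · exact ⟨.parent ⟨0, hΔ⟩ 0, (md_hotBody_parent_pos_iff hN).2 (by omega)⟩

theorem commRounds_typedProgram [Nonempty W] (hΔ : 1 ≤ Δ) :
    (typedProgram ℓ Δ N).toProgram.commRounds M = (· + 1) '' (exchangeTimes ℓ Δ N : Set ℕ) := by
  rw [TypedProgram.commRounds_toProgram]
  ext r
  simp only [Set.mem_image, Finset.mem_coe, ← exists_md_hotBody_pos_iff (M := M) hN hΔ]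
  exact exists_congr fun t => and_comm.trans (and_congr_right fun _ => eq_comm)

end HotBodies

end Colouring

/-! ### The output -/

namespace Colouring

/-- The output round of every node. -/
def outputTime (ℓ Δ N : ℕ) : ℕ := reductionTime ℓ N + (6 + 3 ^ Δ)

theorem acceptsIn_typedProgram_iff {ℓ Δ N : ℕ} {W : Type u} {M : KripkeModel ℓ W} {t : ℕ} {w : W}
    (hN : 1 ≤ N) :
    (typedProgram ℓ Δ N).toProgram.AcceptsIn M w t ↔ t = outputTime ℓ Δ N := by
  have hstep (s : ℕ) : (typedProgram ℓ Δ N).config M s w (.step ⟨3 ^ Δ + 6, by omega⟩) ↔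
      s = reductionTime ℓ N + (3 ^ Δ + 6) := run_step hN
  simp only [TypedProgram.acceptsIn_toProgram, typedProgram, Finset.mem_singleton, exists_eq_left,
    forall_eq] at hstep ⊢
  simp only [hstep, outputTime, Nat.add_comm 6]
  exact ⟨fun h => h.1, fun h => ⟨h, fun s hs => by omega⟩⟩

theorem lt_outputTime_of_mem_exchangeTimes {ℓ Δ N t : ℕ} (ht : t ∈ exchangeTimes ℓ Δ N) :
    t < outputTime ℓ Δ N := by
  have hpow : 0 < 3 ^ Δ := by positivity
  simp only [exchangeTimes, Finset.mem_union, mem_image_mul_range_iff, Finset.mem_Ico] at ht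
  unfold outputTime
  omega

section ProperColouring

variable {n Δ N : ℕ} {W : Type u} {M : KripkeModel (bitLog n) W} (hM : M.IsGraphModel Δ)
  (hN : logStar n + 3 ≤ N) (hΔ : 1 ≤ Δ)
include hM hN hΔ

theorem run_outputTime_palette {w : W} {a : Fin (Δ + 1)} :
    run Δ N M (outputTime (bitLog n) Δ N) w (.palette a) ↔
      greedyColouring M.R (Δ + 1) (colourCode N M Δ) (3 ^ Δ - (Δ + 1)) w = some ↑a := by
  have hpow := succ_lt_three_pow hΔ
  rw [← run_palette hM hN hΔ le_rfl,
    show 7 + Δ + (3 ^ Δ - (Δ + 1)) = 6 + 3 ^ Δ by omega, outputTime]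

theorem exists_run_outputTime_palette_iff (w : W) : ∃ a : Fin (Δ + 1), ∀ b : Fin (Δ + 1),
    run Δ N M (outputTime (bitLog n) Δ N) w (.palette b) ↔ b = a := by
  have := hM.finite
  have hpow := succ_lt_three_pow hΔ
  have hcode := colourCode_lt hM hN w Δ
  obtain ⟨a, ha⟩ := Option.isSome_iff_exists.1 <|
    (isSome_greedyColouring (R := M.R) (k := Δ + 1) (3 ^ Δ - (Δ + 1)) w).2
      (show colourCode N M Δ w < _ by omega)
  have hlt : a < Δ + 1 := greedyColouring_lt (fun _ => Set.toFinite _)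
    (fun v => Nat.lt_succ_of_le (hM.degree_le v)) ha
  refine ⟨⟨a, hlt⟩, fun b => ?_⟩
  rw [run_outputTime_palette hM hN hΔ, ha, Option.some.injEq, Fin.ext_iff, eq_comm]

theorem not_run_outputTime_palette_of_adj {v w : W} (h : M.R v w) {a : Fin (Δ + 1)}
    (hv : run Δ N M (outputTime (bitLog n) Δ N) v (.palette a)) :
    ¬ run Δ N M (outputTime (bitLog n) Δ N) w (.palette a) := by
  have := hM.finite
  rw [run_outputTime_palette hM hN hΔ] at hv ⊢
  exact mem_freeColours_of_greedyColouring (fun _ => Set.toFinite _) hM.symm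
    (colourCode_ne hM hN) hv w h

end ProperColouring

theorem definesProperColoring_typedProgram {n Δ N : ℕ} (hN : logStar n + 3 ≤ N) (hΔ : 1 ≤ Δ) :
    Program.DefinesProperColoring.{u} (typedProgram (bitLog n) Δ N).toProgram (Δ + 1) := by
  intro W M hM
  have hpos : 1 ≤ N := Nat.one_le_of_lt hN
  have hprint (X : Head (bitLog n) Δ N) :
      X ∈ (typedProgram (bitLog n) Δ N).print ↔ ∃ a, .palette a = X := by
    simp only [typedProgram, Finset.mem_map, Finset.mem_univ, true_and]
    rfl
  have hcard : (typedProgram (bitLog n) Δ N).print.card = Δ + 1 := by simp [typedProgram]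
  refine ⟨fun w => ?_, ?_⟩
  · obtain ⟨c, hc⟩ := exists_run_outputTime_palette_iff hM hN hΔ w
    obtain ⟨a, b, ha, hab⟩ := (typedProgram (bitLog n) Δ N).printString_toProgram M
      (w := w) (t := outputTime (bitLog n) Δ N) ((hprint _).2 ⟨c, rfl⟩) fun Y hY => by
        obtain ⟨b, rfl⟩ := (hprint Y).1 hY
        exact (hc b).trans (by rw [Head.palette.injEq])
    exact ⟨_, a, b, hcard ▸ ha, (acceptsIn_typedProgram_iff hpos).2 rfl, hab⟩
  · rintro v w hvw t t' s s' ⟨ht, hs⟩ ⟨ht', hs'⟩ rfl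
    obtain rfl := (acceptsIn_typedProgram_iff hpos).1 ht
    obtain rfl := (acceptsIn_typedProgram_iff hpos).1 ht'
    obtain ⟨c, hc⟩ := exists_run_outputTime_palette_iff hM hN hΔ v
    have hsame := (typedProgram (bitLog n) Δ N).config_iff_of_printString_eq M
      (hs.trans hs'.symm) ((hprint (.palette c)).2 ⟨c, rfl⟩)
    exact not_run_outputTime_palette_of_adj hM hN hΔ hvw ((hc c).2 rfl) (hsame.1 ((hc c).2 rfl))

end Colouring

/-! ### The bounds -/

theorem bitLog_isBigO_log : (fun n : ℕ => (bitLog n : ℝ)) =O[atTop] fun n : ℕ => Real.log n := by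
  refine IsBigO.of_bound (2 / Real.log 2) ?_
  filter_upwards [eventually_ge_atTop 2] with n hn
  have hlog_two : 0 < Real.log 2 := Real.log_pos one_lt_two
  have hlog : Real.log 2 ≤ Real.log n := Real.log_le_log two_pos (by exact_mod_cast hn)
  have hfloor : (Nat.log 2 n : ℝ) * Real.log 2 ≤ Real.log n := by
    rw [← Real.log_pow]
    exact Real.log_le_log (by positivity) (by exact_mod_cast Nat.pow_log_le_self 2 (by omega))
  rw [Real.norm_of_nonneg (Nat.cast_nonneg _), Real.norm_of_nonneg (hlog_two.le.trans hlog),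
    div_mul_eq_mul_div, le_div_iff₀ hlog_two, bitLog, Nat.cast_succ]
  linarith

/-- The colouring program for graphs with identifiers of `bitLog n` bits. It has three more phases
than the reduction to six colours needs: the number of phases determines the number of global
communication rounds. -/
noncomputable def colouringProgram (Δ n : ℕ) : Program (bitLog n) Δ :=
  (Colouring.typedProgram (bitLog n) Δ (logStar n + 6)).toProgram

namespace colouringProgram

open Colouring

variable {Δ n : ℕ}

theorem definesProperColoring (hΔ : 1 ≤ Δ) :
    Program.DefinesProperColoring.{u} (colouringProgram Δ n) (Δ + 1) :=
  definesProperColoring_typedProgram (by omega) hΔ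

theorem heads_le (hΔ : 1 ≤ Δ) :
    (colouringProgram Δ n).heads ≤ 40 * (Δ * bitLog n + 3 ^ Δ) :=
  heads_toProgram_le (Nat.succ_pos _) hΔ (Nat.add_le_add_right (logStar_le_bitLog n) 6)

theorem size_le (hΔ : 1 ≤ Δ) :
    (colouringProgram Δ n).size ≤ 300160 * (Δ ^ 2 * bitLog n + 3 ^ Δ) :=
  size_toProgram_le (Nat.succ_pos _) hΔ (Nat.add_le_add_right (logStar_le_bitLog n) 6)

theorem size_isBigO_log (hΔ : 1 ≤ Δ) :
    (fun n : ℕ => ((colouringProgram Δ n).size : ℝ)) =O[atTop] fun n : ℕ => Real.log n := by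
  refine IsBigO.trans (IsBigO.of_bound (300160 * (Δ ^ 2 + 3 ^ Δ)) (.of_forall fun n => ?_))
    bitLog_isBigO_log
  rw [Real.norm_of_nonneg (Nat.cast_nonneg _), Real.norm_of_nonneg (Nat.cast_nonneg _)]
  have hbound : (colouringProgram Δ n).size ≤ 300160 * (Δ ^ 2 + 3 ^ Δ) * bitLog n :=
    calc (colouringProgram Δ n).size ≤ 300160 * (Δ ^ 2 * bitLog n + 3 ^ Δ) := size_le hΔ
      _ ≤ 300160 * (Δ ^ 2 * bitLog n + 3 ^ Δ * bitLog n) := by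
        gcongr
        exact Nat.le_mul_of_pos_right _ (Nat.succ_pos _)
      _ = 300160 * (Δ ^ 2 + 3 ^ Δ) * bitLog n := by ring
  exact_mod_cast hbound

theorem outputTime_le (hΔ : 1 ≤ Δ) (hn : 1 ≤ n) : outputTime (bitLog n) Δ (logStar n + 6) ≤
    100 * (bitLog n * bitLog (bitLog n) * logStar n + Δ * 3 ^ Δ) := by
  have hpow : 3 ≤ 3 ^ Δ := Nat.le_self_pow (by omega) 3
  have hpow' : 3 ^ Δ ≤ Δ * 3 ^ Δ := Nat.le_mul_of_pos_left _ hΔ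
  unfold outputTime reductionTime
  rcases hn.eq_or_lt with rfl | hn
  · have hstar : logStar 1 ≤ 1 := logStar_le_bitLog 1
    have hbit : bitLog 1 = 1 := by simp [bitLog]
    rw [hbit, hbit]
    omega
  · have hstar : 1 ≤ logStar n := one_le_logStar hn
    have hbit : 1 ≤ bitLog n := Nat.succ_pos _
    have hphases : (bitLog n + 4) * (logStar n + 6) ≤
        35 * (bitLog n * bitLog (bitLog n) * logStar n) :=
      calc (bitLog n + 4) * (logStar n + 6) ≤ (5 * bitLog n) * (7 * logStar n) :=
            Nat.mul_le_mul (by omega) (by omega)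
        _ = 35 * (bitLog n * logStar n) := by ring
        _ ≤ 35 * (bitLog n * bitLog (bitLog n) * logStar n) := by
            gcongr
            exact Nat.le_mul_of_pos_right _ (Nat.succ_pos _)
    omega

variable {W : Type u} {M : KripkeModel (bitLog n) W}

theorem acceptsIn_iff {w : W} {t : ℕ} :
    (colouringProgram Δ n).AcceptsIn M w t ↔ t = outputTime (bitLog n) Δ (logStar n + 6) :=
  acceptsIn_typedProgram_iff (Nat.succ_pos _)

theorem encard_commRounds (hM : M.IsGraphModel Δ) (hΔ : 1 ≤ Δ) :
    ((colouringProgram Δ n).commRounds M).encard = (logStar n + (3 ^ Δ - Δ) + 11 : ℕ) := by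
  have := hM.nonempty
  have hpow := succ_lt_three_pow hΔ
  rw [colouringProgram, commRounds_typedProgram (Nat.succ_pos _) hΔ,
    (add_left_injective 1).encard_image, Set.encard_coe_eq_coe_finsetCard, card_exchangeTimes hΔ]
  congr 1
  omega

theorem commRounds_subset_Iic (hM : M.IsGraphModel Δ) (hΔ : 1 ≤ Δ) {w : W} {t : ℕ}
    (ht : (colouringProgram Δ n).AcceptsIn M w t) :
    (colouringProgram Δ n).commRounds M ⊆ Set.Iic t := by
  have := hM.nonempty
  rw [acceptsIn_iff.1 ht, colouringProgram, commRounds_typedProgram (Nat.succ_pos _) hΔ]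
  exact Set.image_subset_iff.2 fun s hs => lt_outputTime_of_mem_exchangeTimes hs

end colouringProgram

end MPMSC

theorem mainTheorem7 :
    ∃ P : (Δ n : ℕ) → Program (bitLog n) Δ,
      (∀ Δ n, 1 ≤ Δ → 1 ≤ n → Program.DefinesProperColoring.{u} (P Δ n) (Δ + 1)) ∧
      (∃ C : ℕ, ∀ Δ n, 1 ≤ Δ → 1 ≤ n →
        (P Δ n).heads ≤ C * (Δ * bitLog n + 3 ^ Δ) ∧
        (P Δ n).size ≤ C * (Δ ^ 2 * bitLog n + 3 ^ Δ)) ∧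
      (∃ C : ℕ, ∀ Δ n, 1 ≤ Δ → 1 ≤ n →
        ∀ (W : Type u) (M : KripkeModel (bitLog n) W), M.IsGraphModel Δ →
          ∀ w, ∃ t, (P Δ n).AcceptsIn M w t ∧
            t ≤ C * (bitLog n * bitLog (bitLog n) * logStar n + Δ * 3 ^ Δ)) ∧
      (∀ Δ n, 1 ≤ Δ → 1 ≤ n →
        ∀ (W : Type u) (M : KripkeModel (bitLog n) W), M.IsGraphModel Δ →
          ((P Δ n).commRounds M).encard = (logStar n + (3 ^ Δ - Δ) + 11 : ℕ) ∧
          ∀ w t, (P Δ n).AcceptsIn M w t →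
            ((P Δ n).commRounds M ∩ Set.Iic t).encard = (logStar n + (3 ^ Δ - Δ) + 11 : ℕ)) ∧
      (∀ Δ, 1 ≤ Δ →
        (fun n : ℕ => ((P Δ n).size : ℝ)) =O[atTop] fun n : ℕ => Real.log n) := by
  refine ⟨fun Δ n => colouringProgram Δ n,
    fun Δ n hΔ _ => colouringProgram.definesProperColoring hΔ,
    ⟨300160, fun Δ n hΔ _ => ⟨(colouringProgram.heads_le hΔ).trans
      (Nat.mul_le_mul_right _ (by norm_num)), colouringProgram.size_le hΔ⟩⟩,
    ⟨100, fun Δ n hΔ hn W M _ w => ⟨_, colouringProgram.acceptsIn_iff.2 rfl,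
      colouringProgram.outputTime_le hΔ hn⟩⟩,
    fun Δ n hΔ _ W M hM => ⟨colouringProgram.encard_commRounds hM hΔ, fun w t ht => ?_⟩,
    fun Δ hΔ => colouringProgram.size_isBigO_log hΔ⟩
  rw [Set.inter_eq_left.2 (colouringProgram.commRounds_subset_Iic hM hΔ ht),
    colouringProgram.encard_commRounds hM hΔ]
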